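/- Let $d\ge 1$, let $\pi$ be a probability measure on $(0,\infty)$, let $b\ge 0$, and let $W$ be a Lévy measure on $\mathbb{R}$ ($W(\{0\})=0$, $\int\min(1,x^2)\,W(dx)<\infty$). Put $$\mathcal K(s)=-\frac b2 s^2+\int_{\mathbb R}\bigl(e^{isx}-1-is\tau(x)\bigr)W(dx),\qquad \tau(x)=x \text{ if } |x|\le 1,\quad \tau(x)=\operatorname{sign}(x)\text{ if }|x|>1 .$$ Let $\Lambda$ be an independently scattered infinitely divisible random measure, defined on a ring $\mathcal S'$ of Borel subsets of $(0,\infty)\times\mathbb R^d$ of finite $\pi\times\mathrm{Leb}$ measure, which is closed under countable intersections and contains an increasing sequence of sets exhausting the space, such that $\log E e^{is\Lambda(A)}=(\pi\times \mathrm{Leb})(A)\,\mathcal K(s)$ for $A\in\mathcal S'$. Let $$X(t)=-\int_0^\infty\!\!\int_{\mathbb R^d}\frac1{2\lambda}e^{-\lambda\|t-u\|}\,\Lambda(du,d\lambda),\qquad t\in\mathbb R^d,$$ be the supCAR random field with characteristic quadruple $(0,b,W,\pi)$, the integral being a Rajput–Rosiński integral: there are simple functions converging to the integrand almost everywhere whose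 integrals over each $A\in\sigma(\mathcal S')$ converge in probability, and $X(t)$ is the limit for the whole space. Assume that either (i) $b>0$, $\int_0^\infty \frac{|\ln\lambda|^d}{\lambda^{d+2}}\pi(d\lambda)<\infty$ and $\int_{|x|\ge1}|x|(\ln|x|)^{d-1}W(dx)<\infty$; or (ii) $b=0$, $\int_0^\infty \frac{|\ln\lambda|^{d-1}}{\lambda^{d+1}}\pi(d\lambda)<\infty$, $\int_{|x|\ge1}|x|(\ln|x|)^{d-1}W(dx)<\infty$, $\int_0^{1/2}\frac{|\ln\lambda|^{d-1}}{\lambda^{d+2}}\int_{|x|\le2\lambda}x^2\,W(dx)\,\pi(d\lambda)<\infty$, and $\int_0^{1/2}\frac{|\ln\lambda|^{d}}{\lambda^{d+2-k}}\int_{2\lambda\le|x|\le1}|x|^{2-k}\,W(dx)\,\pi(d\lambda)<\infty$ for $k=1,2$. Assume also that $E X(t)^2<\infty$ and $E X(t)=0$ for all $t\in\mathbb R^d$. Then $\mathcal K$ is twice continuously differentiable, $\mathcal K''(0)$ is real, and $X$ has the covariance function $r(t)=\operatorname{Cov}(X(s),X(s+t))$ (not depending on $s\in\mathbb R^d$)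 given for $t\ne0$ by $$ r(t)=-c_2\,\mathcal K''(0)\,\|t\|^{\frac d2+1}\int_0^\infty \lambda^{-\frac d2-1}K_{\frac d2+1}(\lambda\|t\|)\,\pi(d\lambda),$$ where $K_\nu$ is the modified Bessel function of the second kind; for $t=0$ the formula is understood as its limit, i.e. $x^{\nu}K_\nu(x)$ is replaced by $2^{\nu-1}\Gamma(\nu)$, $\nu=\frac d2+1$, so that $$r(0)=-c_2\,\mathcal K''(0)\,2^{d/2}\,\Gamma\!\left(\tfrac d2+1\right)\int_0^\infty\lambda^{-d-2}\,\pi(d\lambda).$$ These integrals converge if $\mathcal K''(0)\neq0$; if $\mathcal K''(0)=0$, then $r\equiv 0$. Moreover, $X$ has the spectral density $$ f(\omega)=-c_1^2\,\mathcal K''(0)\int_0^\infty\frac{\pi(d\lambda)}{(\|\omega\|^2+\lambda^2)^{d+1}},\qquad \omega\ne0,$$ that is, $f$ is nonnegative and integrable and $r(t)=\int_{\mathbb R^d}e^{i\langle\omega,t\rangle}f(\omega)\,d\omega$ for all $t\in\mathbb{R}^d$; the integral defining $f(\omega)$ converges for every $\omega\neq 0$. Here $$c_1=\begin{cases}-2^{d/2-1}\,\Gamma\!\left(\frac{d+1}2\right)/\sqrt{\pi},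 & d\text{ odd},\\[2pt] -2^{-d/2}\,\Gamma(d)/\Gamma\!\left(\frac d2\right), & d\text{ even},\end{cases}\qquad c_2=\frac{c_1^2}{\Gamma(d+1)}\left(\frac\pi2\right)^{d/2},$$ and in these two constants $\pi$ denotes the number $3.14159\ldots$ -/

import Mathlib

open MeasureTheory ProbabilityTheory Filter Topology

noncomputable section

namespace SupCAR

/-! ### Lévy measures and cumulant functions -/

/-- The truncation function: `τ(x) = x` for `|x| ≤ 1` and `τ(x) = sign x` for `|x| > 1`. -/
def trunc (x : ℝ) : ℝ := if |x| ≤ 1 then x else Real.sign x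

/-- `W` is a Lévy measure on `ℝ`. -/
structure IsLevyMeasure (W : Measure ℝ) : Prop where
  singleton_zero : W {0} = 0
  lintegral_min_lt_top : ∫⁻ x, ENNReal.ofReal (min 1 (x ^ 2)) ∂W < ⊤

/-- The cumulant function `-(b/2) s² + ∫ (e^{isx} - 1 - i s τ(x)) W(dx)` of the infinitely
divisible law with Lévy–Khinchine triplet `(0, b, W)`. -/
def cumulant (b : ℝ) (W : Measure ℝ) (s : ℝ) : ℂ :=
  -((b / 2 * s ^ 2 : ℝ) : ℂ) +
    ∫ x, (Complex.exp (Complex.I * (s * x : ℝ)) - 1 - Complex.I * (s * trunc x : ℝ)) ∂W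

/-! ### Independently scattered random measures and their integrals -/

section RandomMeasure

variable {E Ω : Type*} [MeasurableSpace E] [MeasurableSpace Ω]

/-- `S` is a ring of measurable sets of finite `m`-measure which is closed under countable
intersections and contains an increasing sequence of sets that exhausts the space. -/
structure IsExhaustingDeltaRing (m : Measure E) (S : Set (Set E)) : Prop where
  isSetRing : IsSetRing S
  iInter_mem : ∀ A : ℕ → Set E, (∀ n, A n ∈ S) → (⋂ n, A n) ∈ S
  measurableSet : ∀ A ∈ S, MeasurableSet A
  measure_lt_top : ∀ A ∈ S, m A < ⊤
  exhausting : ∃ A : ℕ → Set E, (∀ n, A n ∈ S) ∧ Monotone A ∧ (⋃ n, A n) = Set.univ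

/-- `Λ` is an independently scattered infinitely divisible random measure on `S`, defined on the
probability space `(Ω, P)`, whose cumulant function factorises as `log E e^{isΛ(A)} = m(A) K(s)`. -/
structure IsIDRandomMeasure (P : Measure Ω) (S : Set (Set E)) (m : Measure E) (K : ℝ → ℂ)
    (Λ : Set E → Ω → ℝ) : Prop where
  measurable : ∀ A ∈ S, Measurable (Λ A)
  indep : ∀ A : ℕ → Set E, (∀ n, A n ∈ S) → Pairwise (fun i j => Disjoint (A i) (A j)) →
    iIndepFun (fun n => Λ (A n)) P
  sigma_additive : ∀ A : ℕ → Set E, (∀ n, A n ∈ S) →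
    Pairwise (fun i j => Disjoint (A i) (A j)) → (⋃ n, A n) ∈ S →
    ∀ᵐ ω ∂P, Tendsto (fun n => ∑ i ∈ Finset.range n, Λ (A i) ω) atTop (𝓝 (Λ (⋃ n, A n) ω))
  cumulant_eq : ∀ A ∈ S, ∀ s : ℝ,
    ∫ ω, Complex.exp (Complex.I * (s * Λ A ω : ℝ)) ∂P = Complex.exp (((m A).toReal : ℂ) * K s)

/-- A simple function `∑ᵢ aᵢ 1_{Aᵢ}` with pairwise disjoint `Aᵢ ∈ S`. -/
structure SimpleFn (S : Set (Set E)) where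
  n : ℕ
  coeff : Fin n → ℝ
  set : Fin n → Set E
  set_mem : ∀ i, set i ∈ S
  disjoint : Pairwise (fun i j => Disjoint (set i) (set j))

/-- The value of a simple function at a point. -/
def SimpleFn.eval {S : Set (Set E)} (F : SimpleFn S) (x : E) : ℝ :=
  ∑ i, (F.set i).indicator (fun _ => F.coeff i) x

/-- The integral `∑ᵢ aᵢ Λ(Aᵢ ∩ A)` of a simple function over `A`. -/
def SimpleFn.integral {S : Set (Set E)} (F : SimpleFn S) (Λ : Set E → Ω → ℝ) (A : Set E)
    (ω : Ω) : ℝ :=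
  ∑ i, F.coeff i * Λ (F.set i ∩ A) ω

/-- `f` is `Λ`-integrable in the sense of Rajput and Rosinski, and the random variable `Y` is (a
version of) its integral `∫ f dΛ`: there are simple functions converging to `f` almost everywhere
whose integrals over every `A ∈ σ(S)` converge in probability, the limit for the whole space
being `Y`. -/
def IsRRIntegral (P : Measure Ω) (S : Set (Set E)) (m : Measure E) (Λ : Set E → Ω → ℝ)
    (f : E → ℝ) (Y : Ω → ℝ) : Prop :=
  ∃ F : ℕ → SimpleFn S,
    (∀ᵐ x ∂m, Tendsto (fun n => (F n).eval x) atTop (𝓝 (f x))) ∧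
    (∀ A : Set E, MeasurableSet[MeasurableSpace.generateFrom S] A →
      ∃ Z : Ω → ℝ, TendstoInMeasure P (fun n => (F n).integral Λ A) atTop Z) ∧
    TendstoInMeasure P (fun n => (F n).integral Λ Set.univ) atTop Y

end RandomMeasure

/-! ### supCAR fields -/

/-- The half line `(0, ∞)`. -/
abbrev PosReal : Type := Set.Ioi (0 : ℝ)

/-- `ℝᵈ` with the Euclidean norm. -/
abbrev Space (d : ℕ) : Type := EuclideanSpace ℝ (Fin d)

/-- The integrand `(l, u) ↦ -(1 / (2 l)) e^{-l ‖t - u‖}` of a supCAR field at the point `t`. -/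
def kernel {d : ℕ} (t : Space d) (p : PosReal × Space d) : ℝ :=
  -(1 / (2 * (p.1 : ℝ)) * Real.exp (-(p.1 : ℝ) * ‖t - p.2‖))

/-- `X` is a supCAR random field on `ℝᵈ` with characteristic quadruple `(0, b, W, π)`: there is an
independently scattered infinitely divisible random measure `Λ` with control measure `π × Leb`
and cumulant function `cumulant b W` such that
`X(t) = -∫∫ (1 / (2 l)) e^{-l ‖t - u‖} Λ(du, dl)` for every `t`. -/
def IsSupCAR {Ω : Type*} [MeasurableSpace Ω] (P : Measure Ω) {d : ℕ} (b : ℝ) (W : Measure ℝ)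
    (π : Measure PosReal) (X : Space d → Ω → ℝ) : Prop :=
  ∃ (S : Set (Set (PosReal × Space d))) (Λ : Set (PosReal × Space d) → Ω → ℝ),
    IsExhaustingDeltaRing (π.prod volume) S ∧
    IsIDRandomMeasure P S (π.prod volume) (cumulant b W) Λ ∧
    ∀ t, IsRRIntegral P S (π.prod volume) Λ (kernel t) (X t)

/-- The integrability conditions on `(b, W, π)` under which the supCAR field is well defined. -/
def ExistenceCondition (d : ℕ) (b : ℝ) (W : Measure ℝ) (π : Measure PosReal) : Prop :=
  (0 < b ∧
    ∫⁻ l : PosReal, ENNReal.ofReal (|Real.log l| ^ d / (l : ℝ) ^ (d + 2)) ∂π < ⊤ ∧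
    ∫⁻ x in {x : ℝ | 1 ≤ |x|}, ENNReal.ofReal (|x| * Real.log |x| ^ (d - 1)) ∂W < ⊤) ∨
  (b = 0 ∧
    ∫⁻ l : PosReal, ENNReal.ofReal (|Real.log l| ^ (d - 1) / (l : ℝ) ^ (d + 1)) ∂π < ⊤ ∧
    ∫⁻ x in {x : ℝ | 1 ≤ |x|}, ENNReal.ofReal (|x| * Real.log |x| ^ (d - 1)) ∂W < ⊤ ∧
    ∫⁻ l in {l : PosReal | (l : ℝ) ≤ 1 / 2},
      ENNReal.ofReal (|Real.log l| ^ (d - 1) / (l : ℝ) ^ (d + 2)) *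
        ∫⁻ x in {x : ℝ | |x| ≤ 2 * (l : ℝ)}, ENNReal.ofReal (x ^ 2) ∂W ∂π < ⊤ ∧
    ∀ k : ℕ, (k = 1 ∨ k = 2) →
      ∫⁻ l in {l : PosReal | (l : ℝ) ≤ 1 / 2},
        ENNReal.ofReal (|Real.log l| ^ d / (l : ℝ) ^ (d + 2 - k)) *
          ∫⁻ x in {x : ℝ | 2 * (l : ℝ) ≤ |x| ∧ |x| ≤ 1},
            ENNReal.ofReal (|x| ^ (2 - k)) ∂W ∂π < ⊤)

/-! ### Covariance functions, spectral densities and the constants -/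

/-- `r` is the covariance function of the (weakly homogeneous) field `X`. -/
def IsCovarianceFunction {Ω : Type*} [MeasurableSpace Ω] (P : Measure Ω) {d : ℕ}
    (X : Space d → Ω → ℝ) (r : Space d → ℝ) : Prop :=
  ∀ s t : Space d, cov[X s, X (s + t); P] = r t

/-- `f` is a spectral density of the covariance function `r`: `f` is nonnegative and integrable
and `r(t) = ∫ e^{i⟨ω, t⟩} f(ω) dω` for all `t`. -/
def IsSpectralDensity {d : ℕ} (r f : Space d → ℝ) : Prop :=
  (∀ ω, 0 ≤ f ω) ∧ Integrable f volume ∧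
    ∀ t, (r t : ℂ) = ∫ ω : Space d, Complex.exp (Complex.I * (inner ℝ ω t : ℝ)) * (f ω : ℂ)

/-- The modified Bessel function of the second kind of order `ν` at `x > 0`, through
`K_ν(x) = ∫₀^∞ e^{-x cosh u} cosh(ν u) du`. -/
def besselK (ν x : ℝ) : ℝ :=
  ∫ u in Set.Ioi (0 : ℝ), Real.exp (-x * Real.cosh u) * Real.cosh (ν * u)

/-- The constant `c₁`. -/
def c₁ (d : ℕ) : ℝ :=
  if Odd d then -((2 : ℝ) ^ ((d : ℝ) / 2 - 1) * Real.Gamma (((d : ℝ) + 1) / 2) / √Real.pi)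
  else -((2 : ℝ) ^ (-(d : ℝ) / 2) * Real.Gamma d / Real.Gamma ((d : ℝ) / 2))

/-- The constant `c₂`. -/
def c₂ (d : ℕ) : ℝ :=
  c₁ d ^ 2 / Real.Gamma ((d : ℝ) + 1) * (Real.pi / 2) ^ ((d : ℝ) / 2)

end SupCAR

end

/-! The core is an isometry: if `Y = ∫ f dΛ` has a finite second moment, then `Var Y = (b + ∫ x² dW)
· ∫ f² dm`, where `b + ∫ x² dW = -K''(0)` (`IsApprox.variance_eq`). It is read off the modulus of
the characteristic function, `|E e^{iθY}| = exp (-∫ ψ(θ f) dm)` with `ψ = -Re K ≥ 0`. As `θ → 0` the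
left side is `1 - θ² Var Y / 2 + o(θ²)`, while `θ⁻² ψ(θ s)` tends to `(b + ∫ x² dW) s² / 2` and
never exceeds it, so Fatou's lemma and this bound identify the limit of the exponent.

The modulus formula is immediate for step functions. To reach a general integrand, known only as an
almost everywhere limit of step functions `fₙ` with convergent integrals `Yₙ`, the inequality `ψ(s +
t) ≤ (1 + ε) ψ(s) + (1 + 1/ε) ψ(t)` replaces a norm: the characteristic functions of `Yₙ - Yₖ` and
Fatou's lemma give `∫ ψ(fₙ - f) dm → 0`, hence `∫ ψ(fₙ) dm → ∫ ψ(f) dm`.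

The isometry is an identity in `[0, ∞]`. As the kernel is not null, `E X² < ∞` forces `∫ x² dW < ∞`,
so that `K` is twice continuously differentiable. If `K''(0) ≠ 0`, it also forces the kernel to be
square integrable, that is `∫ l^{-d-2} dπ < ∞`. Polarization then yields the covariance `-K''(0) ∫
carCov l t dπ`.

Here `carCov l` is the convolution of `e^{-l‖u‖} / (2l)` with itself. Since `e^{-l‖u‖}` is a mixture
of Gaussians, its Fourier transform is explicit, and its square gives the spectral density. That
square is again a Gaussian mixture; inverting it gives `∫ s^{d/2} exp (-l² s / 4 - ‖t‖² / s) ds`, a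
Bessel function for `t ≠ 0` and a Gamma integral for `t = 0`. -/

noncomputable section

namespace SupCAR

/-! ### Atoms of a finite family of sets -/

section Atom

variable {E ι : Type*}

/-- The atom of the finite family `A` consisting of the points that lie in exactly the sets
`A i` with `i ∈ T`. -/
def atom (A : ι → Set E) (T : Finset ι) : Set E := {x | ∀ i, x ∈ A i ↔ i ∈ T}

lemma disjoint_atom (A : ι → Set E) {T T' : Finset ι} (h : T ≠ T') :
    Disjoint (atom A T) (atom A T') := by
  rw [Set.disjoint_left]
  intro x hx hx'
  exact h (Finset.ext fun i => (hx i).symm.trans (hx' i))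

/-- The atom of the empty index set is the complement of the union, which a ring need not contain;
hence the nonemptiness. -/
lemma atom_mem {S : Set (Set E)} (hS : IsSetRing S) [Fintype ι] {A : ι → Set E}
    (hA : ∀ i, A i ∈ S) {T : Finset ι} (hT : T.Nonempty) : atom A T ∈ S := by
  classical
  have : atom A T = (⋂ i ∈ T, A i) \ ⋃ i ∈ Tᶜ, A i := by
    ext x
    simp only [atom, Set.mem_ofPred_eq, Set.mem_sdiff, Set.mem_iInter, Set.mem_iUnion,
      Finset.mem_compl, exists_prop, not_exists, not_and]
    constructor
    · exact fun h => ⟨fun i hi => (h i).2 hi, fun i hi hx => hi ((h i).1 hx)⟩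
    · exact fun h i => ⟨fun hx => by_contra fun hi => h.2 i hi hx, h.1 i⟩
  rw [this]
  exact hS.sdiff_mem (hS.biInter_mem T hT fun i _ => hA i) (hS.biUnion_mem _ fun i _ => hA i)

lemma biUnion_atom [Fintype ι] [DecidableEq ι] (A : ι → Set E) (i : ι) :
    ⋃ T ∈ (Finset.univ.filter fun T : {T : Finset ι // T.Nonempty} => i ∈ T.1), atom A T.1 =
      A i := by
  classical
  ext x
  simp only [Finset.mem_filter, Finset.mem_univ, true_and, Set.mem_iUnion, exists_prop]
  constructor
  · rintro ⟨T, hi, hx⟩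
    exact (hx i).2 hi
  · intro hx
    exact ⟨⟨Finset.univ.filter fun j => x ∈ A j, i, by simpa using hx⟩, by simpa using hx,
      fun j => by simp⟩

end Atom

/-! ### Characteristic functions of integrals of step functions -/

section RandomMeasure

variable {E Ω : Type*} [MeasurableSpace E] [MeasurableSpace Ω] {P : Measure Ω}
  {S : Set (Set E)} {m : Measure E} {K : ℝ → ℂ} {Λ : Set E → Ω → ℝ}

namespace IsIDRandomMeasure

/-- For the constant sequence `∅` the partial sums `n Λ(∅)` converge, so their increments, all equal
to `Λ(∅)`, tend to zero. -/
lemma ae_empty (hΛ : IsIDRandomMeasure P S m K Λ) (hS : IsSetRing S) :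
    ∀ᵐ ω ∂P, Λ ∅ ω = 0 := by
  have h := hΛ.sigma_additive (fun _ => ∅) (fun _ => hS.empty_mem)
    (fun _ _ _ => Set.disjoint_empty _) (by simpa using hS.empty_mem)
  filter_upwards [h] with ω hω
  simp only [Set.iUnion_empty, Finset.sum_const, Finset.card_range, nsmul_eq_mul] at hω
  have h1 := (tendsto_add_atTop_iff_nat 1).2 hω
  have h2 := h1.sub hω
  have h3 : Tendsto (fun _ : ℕ => Λ ∅ ω) atTop (𝓝 (Λ ∅ ω - Λ ∅ ω)) := by
    refine h2.congr fun n => ?_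
    push_cast
    ring
  have := tendsto_nhds_unique h3 tendsto_const_nhds
  linarith

lemma ae_union (hΛ : IsIDRandomMeasure P S m K Λ) (hS : IsSetRing S) {A B : Set E}
    (hA : A ∈ S) (hB : B ∈ S) (hAB : Disjoint A B) :
    ∀ᵐ ω ∂P, Λ (A ∪ B) ω = Λ A ω + Λ B ω := by
  let D : ℕ → Set E := fun n => if n = 0 then A else if n = 1 then B else ∅
  have hD : ∀ n, D n ∈ S := by
    intro n
    simp only [D]
    split_ifs
    exacts [hA, hB, hS.empty_mem]
  have hdisj : Pairwise (fun i j => Disjoint (D i) (D j)) := by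
    intro i j hij
    simp only [D]
    split_ifs <;> first | omega | simp [hAB.symm]
  have hU : (⋃ n, D n) = A ∪ B := by
    ext x
    simp only [Set.mem_iUnion, Set.mem_union, D]
    constructor
    · rintro ⟨n, hn⟩
      split_ifs at hn
      exacts [Or.inl hn, Or.inr hn, absurd hn (Set.notMem_empty x)]
    · rintro (h | h)
      exacts [⟨0, by simpa using h⟩, ⟨1, by simpa using h⟩]
  have h := hΛ.sigma_additive D hD hdisj (hU ▸ hS.union_mem hA hB)
  filter_upwards [h, hΛ.ae_empty hS] with ω hω h0
  rw [hU] at hω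
  refine tendsto_nhds_unique hω (tendsto_const_nhds.congr' ?_)
  filter_upwards [eventually_ge_atTop 2] with n hn
  obtain ⟨k, rfl⟩ := Nat.exists_eq_add_of_le hn
  rw [Finset.sum_range_add, Finset.sum_eq_zero (s := Finset.range k)]
  · simp [Finset.sum_range_succ, D]
  · intro i _
    have : D (2 + i) = ∅ := by
      have h1 : 2 + i ≠ 1 := by omega
      simp [D, h1]
    rw [this, h0]

lemma ae_biUnion (hΛ : IsIDRandomMeasure P S m K Λ) (hS : IsSetRing S) {ι : Type*}
    (T : Finset ι) (A : ι → Set E) (hA : ∀ i, A i ∈ S)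
    (hd : Pairwise (fun i j => Disjoint (A i) (A j))) :
    ∀ᵐ ω ∂P, Λ (⋃ i ∈ T, A i) ω = ∑ i ∈ T, Λ (A i) ω := by
  classical
  induction T using Finset.induction with
  | empty => simpa using hΛ.ae_empty hS
  | insert i T hi ih =>
    have hdis : Disjoint (A i) (⋃ j ∈ T, A j) := by
      simp only [Set.disjoint_iUnion_right]
      intro j hj
      exact hd (fun h => hi (h ▸ hj))
    filter_upwards [ih, hΛ.ae_union hS (hA i) (hS.biUnion_mem T fun j _ => hA j) hdis] with ω h1 h2
    rw [Finset.set_biUnion_insert, h2, h1, Finset.sum_insert hi]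

lemma integral_cexp_sum [IsProbabilityMeasure P] (hΛ : IsIDRandomMeasure P S m K Λ)
    (hS : IsSetRing S) {ι : Type*} [Fintype ι] (A : ι → Set E) (hA : ∀ i, A i ∈ S)
    (hd : Pairwise (fun i j => Disjoint (A i) (A j))) (a : ι → ℝ) :
    ∫ ω, Complex.exp (Complex.I * (∑ i, a i * Λ (A i) ω : ℝ)) ∂P =
      Complex.exp (∑ i, ((m (A i)).toReal : ℂ) * K (a i)) := by
  classical
  let e := Fintype.equivFin ι
  -- Independence is postulated for sequences only, so the finite family is padded with `∅`.
  let D : ℕ → Set E := fun n => if h : n < Fintype.card ι then A (e.symm ⟨n, h⟩) else ∅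
  have hDe : ∀ i, D (e i) = A i := fun i => by simp [D]
  have hD : ∀ n, D n ∈ S := by
    intro n
    simp only [D]
    split_ifs
    exacts [hA _, hS.empty_mem]
  have hdisj : Pairwise (fun i j => Disjoint (D i) (D j)) := by
    intro i j hij
    simp only [D]
    split_ifs <;> try simp
    apply hd
    simpa using hij
  have hind := (hΛ.indep D hD hdisj).precomp (g := fun i : ι => (e i : ℕ))
    (fun i j hij => e.injective (Fin.ext hij))
  have hind' : iIndepFun (fun i : ι => Λ (A i)) P := by
    convert hind using 2 with i
    simp [hDe]
  have h := hind'.integral_fun_prod_comp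
    (f := fun i x => Complex.exp (Complex.I * (a i * x : ℝ)))
    (fun i => (hΛ.measurable _ (hA i)).aemeasurable)
    (fun i => (by fun_prop : Measurable _).aestronglyMeasurable)
  simp only [hΛ.cumulant_eq _ (hA _)] at h
  rw [Complex.exp_sum, ← h]
  congr 1
  ext ω
  rw [← Complex.exp_sum]
  congr 1
  push_cast
  rw [Finset.mul_sum]

end IsIDRandomMeasure

/-- If `-Re K = ψ`, then the modulus of the characteristic function of `∑ aᵢ Λ(Aᵢ)` is
`exp (-∫ ψ(∑ aᵢ 1_{Aᵢ}) dm)`. -/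
lemma IsIDRandomMeasure.norm_integral_cexp [IsProbabilityMeasure P]
    (hΛ : IsIDRandomMeasure P S m K Λ) (hS : IsExhaustingDeltaRing m S) {ψ : ℝ → ENNReal}
    (h0 : ψ 0 = 0) (htop : ∀ s, ψ s ≠ ⊤) (hre : ∀ s, (K s).re = -(ψ s).toReal)
    {ι : Type*} [Fintype ι] (A : ι → Set E) (hA : ∀ i, A i ∈ S) (a : ι → ℝ) :
    ∫⁻ x, ψ (∑ i, a i * (A i).indicator 1 x) ∂m ≠ ⊤ ∧
    ‖∫ ω, Complex.exp (Complex.I * (∑ i, a i * Λ (A i) ω : ℝ)) ∂P‖ =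
      Real.exp (-(∫⁻ x, ψ (∑ i, a i * (A i).indicator 1 x) ∂m).toReal) := by
  classical
  let J := {T : Finset ι // T.Nonempty}
  let B : J → Set E := fun T => atom A T.1
  have hB : ∀ T, B T ∈ S := fun T => atom_mem hS.isSetRing hA T.2
  have hBd : Pairwise (fun i j => Disjoint (B i) (B j)) :=
    fun T T' h => disjoint_atom A (fun h' => h (Subtype.ext h'))
  -- The value of the step function on the atom of `T`; the given sets may overlap, but the atoms do
  -- not, so independence applies to them.
  let β : J → ℝ := fun T => ∑ i ∈ T.1, a i
  have hψ : ∀ x, ψ (∑ i, a i * (A i).indicator 1 x) =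
      ∑ T : J, (B T).indicator (fun _ => ψ (β T)) x := by
    intro x
    let T₀ : Finset ι := Finset.univ.filter fun i => x ∈ A i
    have hsum : ∑ i, a i * (A i).indicator 1 x = ∑ i ∈ T₀, a i := by
      rw [Finset.sum_filter]
      refine Finset.sum_congr rfl fun i _ => ?_
      by_cases hx : x ∈ A i <;> simp [hx]
    have hmem : ∀ T : J, x ∈ B T ↔ T.1 = T₀ := by
      intro T
      constructor
      · intro h
        ext i
        simp only [T₀, Finset.mem_filter, Finset.mem_univ, true_and]
        exact (h i).symm
      · intro h i
        rw [h]
        simp [T₀]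
    rw [hsum]
    by_cases hT : T₀.Nonempty
    · rw [Finset.sum_eq_single (⟨T₀, hT⟩ : J)]
      · rw [Set.indicator_of_mem ((hmem ⟨T₀, hT⟩).2 rfl)]
      · intro T _ hne
        exact Set.indicator_of_notMem (fun h => hne (Subtype.ext ((hmem T).1 h))) _
      · simp
    -- Outside all the sets the step function vanishes, and `ψ 0 = 0` lets the missing atom be
    -- ignored.
    · rw [Finset.not_nonempty_iff_eq_empty.1 hT, Finset.sum_empty, h0]
      refine (Finset.sum_eq_zero fun T _ => ?_).symm
      exact Set.indicator_of_notMem (fun h => hT ((hmem T).1 h ▸ T.2)) _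
  have hint : ∫⁻ x, ψ (∑ i, a i * (A i).indicator 1 x) ∂m = ∑ T : J, ψ (β T) * m (B T) := by
    simp_rw [hψ]
    rw [lintegral_finsetSum _ fun T _ =>
      measurable_const.indicator (hS.measurableSet _ (hB T))]
    refine Finset.sum_congr rfl fun T _ => ?_
    rw [lintegral_indicator_const (hS.measurableSet _ (hB T))]
  have hfin : ∀ T, ψ (β T) * m (B T) ≠ ⊤ := fun T =>
    ENNReal.mul_ne_top (htop _) (hS.measure_lt_top _ (hB T)).ne
  have hY : ∀ᵐ ω ∂P, ∑ i, a i * Λ (A i) ω = ∑ T, β T * Λ (B T) ω := by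
    have : ∀ i, ∀ᵐ ω ∂P, Λ (A i) ω =
        ∑ T ∈ Finset.univ.filter (fun T : J => i ∈ T.1), Λ (B T) ω := by
      intro i
      have := hΛ.ae_biUnion hS.isSetRing (Finset.univ.filter (fun T : J => i ∈ T.1)) B hB hBd
      rwa [biUnion_atom A i] at this
    filter_upwards [ae_all_iff.2 this] with ω hω
    simp_rw [hω, β, Finset.sum_mul, Finset.mul_sum, Finset.sum_filter]
    rw [Finset.sum_comm]
    refine Finset.sum_congr rfl fun T _ => ?_
    rw [← Finset.sum_filter]
    simp
  rw [hint]
  refine ⟨ENNReal.sum_ne_top.2 fun T _ => hfin T, ?_⟩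
  rw [integral_congr_ae (g := fun ω => Complex.exp (Complex.I * (∑ T, β T * Λ (B T) ω : ℝ)))
    (by filter_upwards [hY] with ω hω; rw [hω]), hΛ.integral_cexp_sum hS.isSetRing B hB hBd β,
    Complex.norm_exp, ENNReal.toReal_sum fun T _ => hfin T]
  congr 1
  rw [Complex.re_sum, ← Finset.sum_neg_distrib]
  refine Finset.sum_congr rfl fun T _ => ?_
  rw [Complex.re_ofReal_mul, hre, ENNReal.toReal_mul]
  ring

end RandomMeasure

/-! ### The real part of the cumulant function -/

/-- The real part of `-cumulant b W`, as an extended nonnegative real number. -/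
def symbol (b : ℝ) (W : Measure ℝ) (s : ℝ) : ENNReal :=
  ENNReal.ofReal (b / 2 * s ^ 2) + ∫⁻ x, ENNReal.ofReal (1 - Real.cos (s * x)) ∂W

/-- The second moment `b + ∫ x² W(dx)` of the Lévy–Khinchine triplet `(0, b, W)`. -/
def levyVariance (b : ℝ) (W : Measure ℝ) : ENNReal :=
  ENNReal.ofReal b + ∫⁻ x, ENNReal.ofReal (x ^ 2) ∂W

section Symbol

variable {b : ℝ} {W : Measure ℝ}

lemma symbol_zero : symbol b W 0 = 0 := by simp [symbol]

lemma symbol_neg (s : ℝ) : symbol b W (-s) = symbol b W s := by simp [symbol]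

/-- The bound is uniform in `|s| ≤ M`, so one `W`-integrable majorant serves both the finiteness and
the continuity of `symbol`. -/
lemma one_sub_cos_le_min {M s : ℝ} (hs : |s| ≤ M) (x : ℝ) :
    1 - Real.cos (s * x) ≤ (2 + M ^ 2) * min 1 (x ^ 2) := by
  have h1 : 1 - Real.cos (s * x) ≤ 2 := by linarith [Real.neg_one_le_cos (s * x)]
  have h2 := Real.one_sub_sq_div_two_le_cos (x := s * x)
  have h3 : s ^ 2 ≤ M ^ 2 := sq_le_sq' (abs_le.1 hs).1 (abs_le.1 hs).2
  rcases le_total 1 (x ^ 2) with h | h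
  · rw [min_eq_left h]
    nlinarith [sq_nonneg M]
  · rw [min_eq_right h]
    nlinarith [mul_le_mul_of_nonneg_right h3 (sq_nonneg x), sq_nonneg x]

lemma lintegral_bound_ne_top (hW : IsLevyMeasure W) (c : ℝ) (hc : 0 ≤ c) :
    ∫⁻ x, ENNReal.ofReal (c * min 1 (x ^ 2)) ∂W ≠ ⊤ := by
  simp_rw [ENNReal.ofReal_mul hc]
  rw [lintegral_const_mul _ (by fun_prop)]
  exact ENNReal.mul_ne_top ENNReal.ofReal_ne_top hW.lintegral_min_lt_top.ne

lemma symbol_ne_top (hW : IsLevyMeasure W) (s : ℝ) : symbol b W s ≠ ⊤ := by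
  refine ENNReal.add_ne_top.2 ⟨ENNReal.ofReal_ne_top, ?_⟩
  refine ne_top_of_le_ne_top (lintegral_bound_ne_top hW (2 + |s| ^ 2) (by positivity)) ?_
  exact lintegral_mono fun x => ENNReal.ofReal_le_ofReal (one_sub_cos_le_min le_rfl x)

lemma continuous_symbol (hW : IsLevyMeasure W) : Continuous (symbol b W) := by
  refine (ENNReal.continuous_ofReal.comp (by fun_prop)).add
    (continuous_iff_continuousAt.2 fun s => ?_)
  refine tendsto_lintegral_filter_of_dominated_convergence
    (fun x => ENNReal.ofReal ((2 + (|s| + 1) ^ 2) * min 1 (x ^ 2)))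
    (Eventually.of_forall fun t => by fun_prop) ?_
    (lintegral_bound_ne_top hW _ (by positivity)) ?_
  · filter_upwards [Metric.ball_mem_nhds s one_pos] with t ht
    refine Eventually.of_forall fun x => ENNReal.ofReal_le_ofReal (one_sub_cos_le_min ?_ x)
    rw [Metric.mem_ball, Real.dist_eq] at ht
    have := abs_sub_abs_le_abs_sub t s
    linarith
  · refine Eventually.of_forall fun x => ?_
    have : Continuous fun t : ℝ => ENNReal.ofReal (1 - Real.cos (t * x)) :=
      ENNReal.continuous_ofReal.comp (by fun_prop)
    exact this.tendsto s

/-- Since `1 - cos y = 2 sin² (y / 2)`, the addition formula for the sine reduces this to Young's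
inequality for a square of a sum, the cosine factors being at most 1 in modulus. -/
lemma one_sub_cos_add_le {ε : ℝ} (hε : 0 < ε) (u v : ℝ) :
    1 - Real.cos (u + v) ≤ (1 + ε) * (1 - Real.cos u) + (1 + 1 / ε) * (1 - Real.cos v) := by
  have key : ∀ y : ℝ, 1 - Real.cos y = 2 * Real.sin (y / 2) ^ 2 := by
    intro y
    have h := Real.cos_two_mul (y / 2)
    rw [mul_div_cancel₀ y two_ne_zero] at h
    nlinarith [Real.sin_sq_add_cos_sq (y / 2)]
  rw [key, key, key]
  have hadd : Real.sin ((u + v) / 2) =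
      Real.sin (u / 2) * Real.cos (v / 2) + Real.cos (u / 2) * Real.sin (v / 2) := by
    rw [add_div, Real.sin_add]
  set p := Real.sin (u / 2)
  set q := Real.sin (v / 2)
  have hp : (p * Real.cos (v / 2)) ^ 2 ≤ p ^ 2 := by
    rw [mul_pow]
    exact mul_le_of_le_one_right (sq_nonneg p) (Real.cos_sq_le_one _)
  have hq : (Real.cos (u / 2) * q) ^ 2 ≤ q ^ 2 := by
    rw [mul_pow]
    exact mul_le_of_le_one_left (sq_nonneg q) (Real.cos_sq_le_one _)
  rw [hadd]
  set y := p * Real.cos (v / 2)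
  set z := Real.cos (u / 2) * q
  have hyz : (y + z) ^ 2 ≤ (1 + ε) * y ^ 2 + (1 + 1 / ε) * z ^ 2 := by
    -- This quotient is exactly the right side minus the left side.
    have : 0 ≤ (ε * y - z) ^ 2 / ε := by positivity
    have h : (ε * y - z) ^ 2 / ε = ε * y ^ 2 - 2 * y * z + 1 / ε * z ^ 2 := by
      field_simp
      ring
    nlinarith
  have h1 : (1 + ε) * y ^ 2 ≤ (1 + ε) * p ^ 2 := by gcongr
  have h2 : (1 + 1 / ε) * z ^ 2 ≤ (1 + 1 / ε) * q ^ 2 := by gcongr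
  linarith

/-- The first factor can be taken arbitrarily close to 1, so that passing to the limit loses no
constant. -/
lemma symbol_add_le (hb : 0 ≤ b) {ε : ℝ} (hε : 0 < ε) (s t : ℝ) :
    symbol b W (s + t) ≤
      ENNReal.ofReal (1 + ε) * symbol b W s + ENNReal.ofReal (1 + 1 / ε) * symbol b W t := by
  have hc : ∀ y : ℝ, 0 ≤ 1 - Real.cos y := fun y => by linarith [Real.cos_le_one y]
  have e1 : (0 : ℝ) ≤ 1 + ε := by positivity
  have e2 : (0 : ℝ) ≤ 1 + 1 / ε := by positivity
  have h1 : ENNReal.ofReal (b / 2 * (s + t) ^ 2) ≤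
      ENNReal.ofReal (1 + ε) * ENNReal.ofReal (b / 2 * s ^ 2) +
        ENNReal.ofReal (1 + 1 / ε) * ENNReal.ofReal (b / 2 * t ^ 2) := by
    rw [← ENNReal.ofReal_mul e1, ← ENNReal.ofReal_mul e2,
      ← ENNReal.ofReal_add (by positivity) (by positivity)]
    apply ENNReal.ofReal_le_ofReal
    have : 0 ≤ (ε * s - t) ^ 2 / ε := by positivity
    have h : (ε * s - t) ^ 2 / ε = ε * s ^ 2 - 2 * s * t + 1 / ε * t ^ 2 := by
      field_simp
      ring
    nlinarith
  have h2 : ∫⁻ x, ENNReal.ofReal (1 - Real.cos ((s + t) * x)) ∂W ≤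
      ENNReal.ofReal (1 + ε) * ∫⁻ x, ENNReal.ofReal (1 - Real.cos (s * x)) ∂W +
        ENNReal.ofReal (1 + 1 / ε) * ∫⁻ x, ENNReal.ofReal (1 - Real.cos (t * x)) ∂W := by
    rw [← lintegral_const_mul _ (by fun_prop), ← lintegral_const_mul _ (by fun_prop),
      ← lintegral_add_left (by fun_prop)]
    refine lintegral_mono fun x => ?_
    rw [← ENNReal.ofReal_mul e1, ← ENNReal.ofReal_mul e2,
      ← ENNReal.ofReal_add (mul_nonneg e1 (hc _)) (mul_nonneg e2 (hc _)), add_mul]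
    exact ENNReal.ofReal_le_ofReal (one_sub_cos_add_le hε _ _)
  refine (add_le_add h1 h2).trans (le_of_eq ?_)
  simp only [symbol]
  ring

lemma symbol_le (s : ℝ) :
    symbol b W s ≤ ENNReal.ofReal (s ^ 2 / 2) * levyVariance b W := by
  have hs : (0 : ℝ) ≤ s ^ 2 / 2 := by positivity
  rw [symbol, levyVariance, mul_add, ← lintegral_const_mul _ (by fun_prop),
    ← ENNReal.ofReal_mul hs]
  refine add_le_add (le_of_eq (by congr 1; ring)) (lintegral_mono fun x => ?_)
  rw [← ENNReal.ofReal_mul hs]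
  apply ENNReal.ofReal_le_ofReal
  have := Real.one_sub_sq_div_two_le_cos (x := s * x)
  nlinarith

lemma tendsto_one_sub_cos_div_sq (y : ℝ) {h : ℕ → ℝ} (h0 : Tendsto h atTop (𝓝 0))
    (hpos : ∀ k, 0 < h k) :
    Tendsto (fun k => (1 - Real.cos (h k * y)) / h k ^ 2) atTop (𝓝 (y ^ 2 / 2)) := by
  have hy : Tendsto (fun k => h k * y) atTop (𝓝 0) := by simpa using h0.mul_const y
  -- The constant 5/96 is the one in `Real.cos_bound`.
  have hlow : Tendsto (fun k => y ^ 2 / 2 - h k ^ 2 * (y ^ 4 * (5 / 96))) atTop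
      (𝓝 (y ^ 2 / 2)) := by
    simpa using (tendsto_const_nhds (x := y ^ 2 / 2)).sub ((h0.pow 2).mul_const (y ^ 4 * (5 / 96)))
  refine tendsto_of_tendsto_of_tendsto_of_le_of_le' hlow tendsto_const_nhds ?_ ?_
  · filter_upwards [hy.abs.eventually_le_const (by simp : |(0 : ℝ)| < 1)] with k hk
    have hb := (abs_le.1 (Real.cos_bound hk)).2
    have h2 := hpos k
    rw [le_div_iff₀ (by positivity)]
    have : |h k * y| ^ 4 = h k ^ 4 * y ^ 4 := by
      rw [← mul_pow, Even.pow_abs (by decide)]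
    rw [this] at hb
    nlinarith
  · refine Eventually.of_forall fun k => ?_
    have h2 := hpos k
    rw [div_le_iff₀ (by positivity)]
    have := Real.one_sub_sq_div_two_le_cos (x := h k * y)
    nlinarith

/-- Fatou's lemma applied to the Lévy part; the Gaussian part is exactly homogeneous of degree two.
Together with `symbol_le` this gives the limit even when `levyVariance` is infinite. -/
lemma le_liminf_symbol (s : ℝ) {h : ℕ → ℝ}
    (h0 : Tendsto h atTop (𝓝 0)) (hpos : ∀ k, 0 < h k) :
    ENNReal.ofReal (s ^ 2 / 2) * levyVariance b W ≤
      liminf (fun k => ENNReal.ofReal (1 / h k ^ 2) * symbol b W (h k * s)) atTop := by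
  have hs : (0 : ℝ) ≤ s ^ 2 / 2 := by positivity
  have hk : ∀ k, (0 : ℝ) ≤ 1 / h k ^ 2 := fun k => by positivity
  have hlim : ∀ x, Tendsto
      (fun k => ENNReal.ofReal (1 / h k ^ 2) * ENNReal.ofReal (1 - Real.cos (h k * s * x)))
      atTop (𝓝 (ENNReal.ofReal (s ^ 2 / 2 * x ^ 2))) := by
    intro x
    have := (ENNReal.continuous_ofReal.tendsto _).comp
      (tendsto_one_sub_cos_div_sq (s * x) h0 hpos)
    refine (this.congr fun k => ?_).trans (le_of_eq ?_)
    · rw [Function.comp_apply, ← ENNReal.ofReal_mul (hk k)]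
      congr 1
      rw [mul_assoc]
      ring
    · congr 2
      ring
  have hint : ∫⁻ x, ENNReal.ofReal (s ^ 2 / 2 * x ^ 2) ∂W ≤
      liminf (fun k => ENNReal.ofReal (1 / h k ^ 2) *
        ∫⁻ x, ENNReal.ofReal (1 - Real.cos (h k * s * x)) ∂W) atTop := by
    simp_rw [← fun k => lintegral_const_mul (μ := W) (ENNReal.ofReal (1 / h k ^ 2))
      (by fun_prop : Measurable fun x => ENNReal.ofReal (1 - Real.cos (h k * s * x)))]
    refine le_trans (le_of_eq ?_) (lintegral_liminf_le fun k => by fun_prop)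
    exact lintegral_congr fun x => (hlim x).liminf_eq.symm
  have hconst : ∀ k, ENNReal.ofReal (1 / h k ^ 2) * symbol b W (h k * s) =
      ENNReal.ofReal (s ^ 2 / 2) * ENNReal.ofReal b + ENNReal.ofReal (1 / h k ^ 2) *
        ∫⁻ x, ENNReal.ofReal (1 - Real.cos (h k * s * x)) ∂W := by
    intro k
    rw [symbol, mul_add, ← ENNReal.ofReal_mul (hk k), ← ENNReal.ofReal_mul hs]
    congr 2
    have := (hpos k).ne'
    field_simp
  simp_rw [hconst]
  rw [levyVariance, mul_add, ← lintegral_const_mul _ (by fun_prop)]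
  simp_rw [← ENNReal.ofReal_mul hs]
  refine le_trans (add_le_add_right hint _) ?_
  rw [liminf_const_add atTop _ _ (by isBoundedDefault) (by isBoundedDefault)]

lemma abs_trunc_le (x : ℝ) : |trunc x| ≤ 1 := by
  unfold trunc
  split_ifs with h
  · exact h
  · rcases lt_trichotomy x 0 with hx | hx | hx
    · simp [Real.sign_of_neg hx]
    · simp [hx]
    · simp [Real.sign_of_pos hx]

lemma measurable_trunc : Measurable trunc := by
  unfold trunc
  refine Measurable.ite (measurableSet_le (by fun_prop) (by fun_prop)) measurable_id ?_
  unfold Real.sign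
  exact Measurable.ite measurableSet_Iio measurable_const
    (Measurable.ite measurableSet_Ioi measurable_const measurable_const)

/-- The integrand of the Lévy–Khinchine representation. -/
def levyIntegrand (s x : ℝ) : ℂ :=
  Complex.exp (Complex.I * (s * x : ℝ)) - 1 - Complex.I * (s * trunc x : ℝ)

lemma measurable_levyIntegrand (s : ℝ) : Measurable (levyIntegrand s) := by
  have := measurable_trunc
  unfold levyIntegrand
  fun_prop

lemma integrable_min (hW : IsLevyMeasure W) : Integrable (fun x : ℝ => min 1 (x ^ 2)) W := by
  refine ⟨by fun_prop, ?_⟩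
  rw [hasFiniteIntegral_iff_ofReal (Eventually.of_forall fun x => by positivity)]
  exact hW.lintegral_min_lt_top

lemma norm_cexp_sub_one_sub_le (y : ℝ) :
    ‖Complex.exp (Complex.I * (y : ℝ)) - 1 - Complex.I * (y : ℝ)‖ ≤ 2 * y ^ 2 := by
  have hn : ‖Complex.I * (y : ℂ)‖ = |y| := by simp
  by_cases hy : |y| ≤ 1
  · have := Complex.norm_exp_sub_one_sub_id_le (x := Complex.I * (y : ℝ)) (by rwa [hn])
    rw [hn, sq_abs] at this
    nlinarith [sq_nonneg y]
  · push Not at hy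
    have h1 := Real.norm_exp_I_mul_ofReal_sub_one_le (x := y)
    have h2 := norm_sub_le (Complex.exp (Complex.I * (y : ℝ)) - 1) (Complex.I * (y : ℝ))
    rw [hn] at h2
    rw [Real.norm_eq_abs] at h1
    nlinarith [sq_abs y]

/-- On `|x| ≤ 1` the truncation cancels the first order term and leaves `O(x²)`; elsewhere every
term is bounded. -/
lemma norm_levyIntegrand_le (s x : ℝ) :
    ‖levyIntegrand s x‖ ≤ (2 + |s| + 2 * s ^ 2) * min 1 (x ^ 2) := by
  unfold levyIntegrand
  by_cases hx : |x| ≤ 1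
  · have h1 : x ^ 2 ≤ 1 := by rw [← sq_abs]; exact pow_le_one₀ (abs_nonneg x) hx
    rw [min_eq_right h1, trunc, if_pos hx]
    refine (norm_cexp_sub_one_sub_le (s * x)).trans ?_
    nlinarith [mul_nonneg (abs_nonneg s) (sq_nonneg x), sq_nonneg x]
  · push Not at hx
    have h1 : 1 ≤ x ^ 2 := by rw [← sq_abs]; exact one_le_pow₀ hx.le
    rw [min_eq_left h1]
    have h2 : ‖Complex.exp (Complex.I * (s * x : ℝ))‖ = 1 := by
      rw [mul_comm, Complex.norm_exp_ofReal_mul_I]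
    have h3 : ‖Complex.I * (s * trunc x : ℝ)‖ ≤ |s| := by
      rw [norm_mul, Complex.norm_I, one_mul, Complex.norm_real, Real.norm_eq_abs, abs_mul]
      exact mul_le_of_le_one_right (abs_nonneg s) (abs_trunc_le x)
    have h4 := norm_sub_le (Complex.exp (Complex.I * (s * x : ℝ)) - 1)
      (Complex.I * (s * trunc x : ℝ))
    have h5 := norm_sub_le (Complex.exp (Complex.I * (s * x : ℝ))) 1
    rw [h2, norm_one] at h5
    nlinarith [sq_nonneg s]

lemma integrable_levyIntegrand (hW : IsLevyMeasure W) (s : ℝ) :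
    Integrable (levyIntegrand s) W :=
  ((integrable_min hW).const_mul _).mono' (measurable_levyIntegrand s).aestronglyMeasurable
    (Eventually.of_forall fun x => norm_levyIntegrand_le s x)

lemma re_levyIntegrand (s x : ℝ) : (levyIntegrand s x).re = -(1 - Real.cos (s * x)) := by
  have : (Complex.exp (Complex.I * (s * x : ℝ))).re = Real.cos (s * x) := by
    rw [mul_comm, Complex.exp_ofReal_mul_I_re]
  simp only [levyIntegrand, Complex.sub_re, this, Complex.one_re, Complex.mul_re, Complex.I_re,
    Complex.I_im, Complex.ofReal_re, Complex.ofReal_im]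
  ring

lemma re_cumulant (hb : 0 ≤ b) (hW : IsLevyMeasure W) (s : ℝ) :
    (cumulant b W s).re = -(symbol b W s).toReal := by
  have h := symbol_ne_top (b := b) hW s
  have hint := integrable_levyIntegrand hW s
  have h1 : (∫ x, levyIntegrand s x ∂W).re = -∫ x, (1 - Real.cos (s * x)) ∂W := by
    rw [← integral_neg, ← Complex.reCLM_apply, ← Complex.reCLM.integral_comp_comm hint]
    exact integral_congr_ae (Eventually.of_forall fun x => re_levyIntegrand s x)
  rw [symbol, ENNReal.add_ne_top] at h
  rw [symbol, ENNReal.toReal_add h.1 h.2, ENNReal.toReal_ofReal (by positivity),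
    ← integral_eq_lintegral_of_nonneg_ae
      (Eventually.of_forall fun x => sub_nonneg.2 (Real.cos_le_one (s * x)))
      (by fun_prop)]
  change (-((b / 2 * s ^ 2 : ℝ) : ℂ) + ∫ x, levyIntegrand s x ∂W).re = _
  rw [Complex.add_re, h1, Complex.neg_re, Complex.ofReal_re]
  ring

end Symbol

/-! ### From step functions to general integrands -/

section Steps

variable {E Ω : Type*} {S : Set (Set E)}

/-- The step function `∑ c_A 1_A` with coefficients `c`. -/
def stepFn : (S →₀ ℝ) →ₗ[ℝ] (E → ℝ) :=
  Finsupp.linearCombination ℝ fun A : S => (A : Set E).indicator 1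

/-- The integral `∑ c_A Λ(A)` of the step function with coefficients `c`. -/
def stepInt (Λ : Set E → Ω → ℝ) : (S →₀ ℝ) →ₗ[ℝ] (Ω → ℝ) :=
  Finsupp.linearCombination ℝ fun A : S => Λ A

lemma stepFn_apply (c : S →₀ ℝ) (x : E) :
    stepFn c x = ∑ A : c.support, c A * ((A : S) : Set E).indicator 1 x := by
  rw [stepFn, Finsupp.linearCombination_apply, Finsupp.sum, Finset.sum_apply,
    ← Finset.sum_coe_sort]
  rfl

lemma stepInt_apply (Λ : Set E → Ω → ℝ) (c : S →₀ ℝ) (ω : Ω) :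
    stepInt Λ c ω = ∑ A : c.support, c A * Λ ((A : S) : Set E) ω := by
  rw [stepInt, Finsupp.linearCombination_apply, Finsupp.sum, Finset.sum_apply,
    ← Finset.sum_coe_sort]
  rfl

variable [MeasurableSpace E] [MeasurableSpace Ω] {P : Measure Ω}
  {m : Measure E} {K : ℝ → ℂ} {Λ : Set E → Ω → ℝ}

lemma measurable_stepFn (hS : IsExhaustingDeltaRing m S) (c : S →₀ ℝ) :
    Measurable (stepFn c) := by
  have : (stepFn c : E → ℝ) = fun x => _ := funext (stepFn_apply c)
  rw [this]
  exact Finset.measurable_sum _ fun A _ => measurable_const.mul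
    (measurable_one.indicator (hS.measurableSet _ A.1.2))

lemma measurable_stepInt (hΛ : IsIDRandomMeasure P S m K Λ) (c : S →₀ ℝ) :
    Measurable (stepInt Λ c) := by
  have : (stepInt Λ c : Ω → ℝ) = fun x => _ := funext (stepInt_apply Λ c)
  rw [this]
  exact Finset.measurable_sum _ fun A _ => measurable_const.mul (hΛ.measurable _ A.1.2)

/-- `Y` is an almost sure limit of integrals of step functions which converge almost everywhere
to `f`. -/
def IsApprox (P : Measure Ω) (S : Set (Set E)) (m : Measure E) (Λ : Set E → Ω → ℝ)
    (f : E → ℝ) (Y : Ω → ℝ) : Prop :=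
  ∃ c : ℕ → (S →₀ ℝ), (∀ᵐ x ∂m, Tendsto (fun n => stepFn (c n) x) atTop (𝓝 (f x))) ∧
    ∀ᵐ ω ∂P, Tendsto (fun n => stepInt Λ (c n) ω) atTop (𝓝 (Y ω))

/-- Coefficients indexed by the ring itself add without any refinement to disjoint sets.
Polarization needs this additivity. -/
lemma IsApprox.add {f g : E → ℝ} {Y Z : Ω → ℝ} (hf : IsApprox P S m Λ f Y)
    (hg : IsApprox P S m Λ g Z) : IsApprox P S m Λ (f + g) (Y + Z) := by
  obtain ⟨c, h1, h2⟩ := hf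
  obtain ⟨c', h1', h2'⟩ := hg
  refine ⟨c + c', ?_, ?_⟩
  · filter_upwards [h1, h1'] with x hx hx'
    simpa using hx.add hx'
  · filter_upwards [h2, h2'] with x hx hx'
    simpa using hx.add hx'

lemma IsApprox.smul {f : E → ℝ} {Y : Ω → ℝ} (hf : IsApprox P S m Λ f Y) (a : ℝ) :
    IsApprox P S m Λ (a • f) (a • Y) := by
  obtain ⟨c, h1, h2⟩ := hf
  refine ⟨a • c, ?_, ?_⟩
  · filter_upwards [h1] with x hx
    simpa using hx.const_mul a
  · filter_upwards [h2] with x hx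
    simpa using hx.const_mul a

/-- Convergence in probability over the whole space becomes almost sure along a subsequence. -/
lemma IsRRIntegral.isApprox {f : E → ℝ} {Y : Ω → ℝ} (h : IsRRIntegral P S m Λ f Y) :
    IsApprox P S m Λ f Y := by
  obtain ⟨F, hF, -, hY⟩ := h
  obtain ⟨ns, hns, hlim⟩ := hY.exists_seq_tendsto_ae
  -- A sum of `Finsupp.single`, because the empty set may occur several times among the disjoint
  -- sets.
  let c : ℕ → (S →₀ ℝ) := fun n =>
    ∑ i, Finsupp.single ⟨(F (ns n)).set i, (F (ns n)).set_mem i⟩ ((F (ns n)).coeff i)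
  have h1 : ∀ n, stepFn (c n) = (F (ns n)).eval := by
    intro n
    ext x
    simp only [c, map_sum, stepFn, Finsupp.linearCombination_single, Finset.sum_apply,
      SimpleFn.eval]
    refine Finset.sum_congr rfl fun i _ => ?_
    by_cases hx : x ∈ (F (ns n)).set i <;> simp [hx]
  have h2 : ∀ n, stepInt Λ (c n) = (F (ns n)).integral Λ Set.univ := by
    intro n
    ext ω
    simp [c, map_sum, stepInt, SimpleFn.integral]
  refine ⟨c, ?_, ?_⟩
  · filter_upwards [hF] with x hx
    simp_rw [h1]
    exact hx.comp hns.tendsto_atTop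
  · filter_upwards [hlim] with ω hω
    simpa [h2] using hω

lemma IsApprox.aemeasurable (hS : IsExhaustingDeltaRing m S) {f : E → ℝ} {Y : Ω → ℝ}
    (hf : IsApprox P S m Λ f Y) : AEMeasurable f m := by
  obtain ⟨c, h1, -⟩ := hf
  exact aemeasurable_of_tendsto_metrizable_ae' (fun n => (measurable_stepFn hS (c n)).aemeasurable)
    h1

variable [IsProbabilityMeasure P]

lemma tendsto_integral_cexp {Y : ℕ → Ω → ℝ} {Z : Ω → ℝ} (hY : ∀ n, AEMeasurable (Y n) P)
    (h : ∀ᵐ ω ∂P, Tendsto (fun n => Y n ω) atTop (𝓝 (Z ω))) :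
    Tendsto (fun n => ‖∫ ω, Complex.exp (Complex.I * (Y n ω : ℝ)) ∂P‖) atTop
      (𝓝 ‖∫ ω, Complex.exp (Complex.I * (Z ω : ℝ)) ∂P‖) := by
  refine (tendsto_integral_of_dominated_convergence (fun _ => (1 : ℝ)) (fun n => ?_)
    (integrable_const _) (fun n => Eventually.of_forall fun ω => ?_) ?_).norm
  · have := hY n
    exact AEMeasurable.aestronglyMeasurable (by fun_prop)
  · rw [mul_comm, Complex.norm_exp_ofReal_mul_I]
  · filter_upwards [h] with ω hω
    have : Continuous fun y : ℝ => Complex.exp (Complex.I * (y : ℝ)) := by fun_prop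
    exact (this.tendsto _).comp hω

/-- If `-Re K = ψ` is continuous, even, and satisfies the inequality
`ψ(s + t) ≤ (1 + ε) ψ(s) + (1 + 1/ε) ψ(t)`, then the modulus of the characteristic function of an
integral `Y = ∫ f dΛ` is `exp (-∫ ψ(f) dm)`. -/
lemma IsApprox.norm_integral_cexp (hΛ : IsIDRandomMeasure P S m K Λ)
    (hS : IsExhaustingDeltaRing m S) {ψ : ℝ → ENNReal}
    (h0 : ψ 0 = 0) (htop : ∀ s, ψ s ≠ ⊤) (hre : ∀ s, (K s).re = -(ψ s).toReal)
    (hcont : Continuous ψ) (heven : ∀ s, ψ (-s) = ψ s)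
    (hadd : ∀ ε : ℝ, 0 < ε → ∀ s t, ψ (s + t) ≤
      ENNReal.ofReal (1 + ε) * ψ s + ENNReal.ofReal (1 + 1 / ε) * ψ t)
    {f : E → ℝ} {Y : Ω → ℝ} (hf : IsApprox P S m Λ f Y) :
    ∫⁻ x, ψ (f x) ∂m ≠ ⊤ ∧
    ‖∫ ω, Complex.exp (Complex.I * (Y ω : ℝ)) ∂P‖ =
      Real.exp (-(∫⁻ x, ψ (f x) ∂m).toReal) := by
  have hfm := hf.aemeasurable hS
  obtain ⟨c, hc, hY⟩ := hf
  have hfn : ∀ n, Measurable (stepFn (c n)) := fun n => measurable_stepFn hS (c n)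
  have key : ∀ c : S →₀ ℝ, ∫⁻ x, ψ (stepFn c x) ∂m ≠ ⊤ ∧
      ‖∫ ω, Complex.exp (Complex.I * (stepInt Λ c ω : ℝ)) ∂P‖ =
        Real.exp (-(∫⁻ x, ψ (stepFn c x) ∂m).toReal) := by
    intro c
    simp_rw [stepFn_apply, stepInt_apply]
    exact hΛ.norm_integral_cexp hS h0 htop hre (fun A : c.support => ((A : S) : Set E))
      (fun A => A.1.2) (fun A => c A)
  have hψn : ∀ n, Measurable fun x => ψ (stepFn (c n) x) := fun n => hcont.measurable.comp (hfn n)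
  have hψf : AEMeasurable (fun x => ψ (f x)) m := hcont.measurable.comp_aemeasurable hfm
  -- the distance from the approximating step functions tends to zero
  set ρ : ℕ → ℝ := fun n => ‖∫ ω, Complex.exp (Complex.I * (stepInt Λ (c n) ω - Y ω : ℝ)) ∂P‖
    with hρ
  have hYm : AEMeasurable Y P := aemeasurable_of_tendsto_metrizable_ae'
    (fun n => (measurable_stepInt hΛ (c n)).aemeasurable) hY
  have hρ1 : Tendsto ρ atTop (𝓝 1) := by
    have := tendsto_integral_cexp (P := P) (Y := fun n ω => stepInt Λ (c n) ω - Y ω) (Z := 0)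
      (fun n => (measurable_stepInt hΛ (c n)).aemeasurable.sub hYm) (by
        filter_upwards [hY] with ω hω
        simpa using hω.sub_const (Y ω))
    simpa [hρ] using this
  -- `fₙ - f` is not a step function, so the formula is applied to `fₙ - fₖ`; as `k → ∞`, Fatou's
  -- lemma leaves an inequality, which is enough.
  have hδ : ∀ n, ρ n ≠ 0 →
      ∫⁻ x, ψ (stepFn (c n) x - f x) ∂m ≤ ENNReal.ofReal (-Real.log (ρ n)) := by
    intro n hn
    have hk : Tendsto (fun k => ‖∫ ω, Complex.exp
        (Complex.I * (stepInt Λ (c n - c k) ω : ℝ)) ∂P‖) atTop (𝓝 (ρ n)) := by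
      refine tendsto_integral_cexp (fun k => (measurable_stepInt hΛ _).aemeasurable) ?_
      filter_upwards [hY] with ω hω
      simpa using hω.const_sub (stepInt Λ (c n) ω)
    have hk' : Tendsto (fun k => ∫⁻ x, ψ (stepFn (c n - c k) x) ∂m) atTop
        (𝓝 (ENNReal.ofReal (-Real.log (ρ n)))) := by
      have := (ENNReal.continuous_ofReal.tendsto _).comp
        (((Real.continuousAt_log hn).tendsto.comp hk).neg)
      refine this.congr fun k => ?_
      simp only [Function.comp_apply]
      rw [(key _).2, Real.log_exp, neg_neg, ENNReal.ofReal_toReal (key _).1]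
    rw [← hk'.liminf_eq]
    refine le_trans (le_of_eq ?_) (lintegral_liminf_le fun k =>
      hcont.measurable.comp (measurable_stepFn hS _))
    refine lintegral_congr_ae ?_
    filter_upwards [hc] with x hx
    have : Tendsto (fun k => stepFn (c n - c k) x) atTop (𝓝 (stepFn (c n) x - f x)) := by
      simpa using hx.const_sub (stepFn (c n) x)
    exact ((hcont.tendsto _).comp this).liminf_eq.symm
  have hρne : ∀ᶠ n in atTop, ρ n ≠ 0 := hρ1.eventually_ne one_ne_zero
  set δ : ℕ → ENNReal := fun n => ∫⁻ x, ψ (stepFn (c n) x - f x) ∂m with hδdef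
  have hδ0 : Tendsto δ atTop (𝓝 0) := by
    have h1 : Tendsto (fun n => ENNReal.ofReal (-Real.log (ρ n))) atTop (𝓝 0) := by
      have := (ENNReal.continuous_ofReal.tendsto _).comp
        (((Real.continuousAt_log one_ne_zero).tendsto.comp hρ1).neg)
      simpa [Function.comp_def] using this
    exact tendsto_of_tendsto_of_tendsto_of_le_of_le' tendsto_const_nhds h1
      (Eventually.of_forall fun _ => zero_le) (hρne.mono hδ)
  set N : ENNReal := ∫⁻ x, ψ (f x) ∂m with hN
  set a : ℕ → ENNReal := fun n => ∫⁻ x, ψ (stepFn (c n) x) ∂m with ha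
  have hatop : ∀ n, a n ≠ ⊤ := fun n => (key (c n)).1
  -- Quasi-triangle inequality for `f = fₙ + (f - fₙ)`; `hle2` exchanges the roles of `f` and `fₙ`.
  have hle1 : ∀ ε : ℝ, 0 < ε → ∀ n,
      N ≤ ENNReal.ofReal (1 + ε) * a n + ENNReal.ofReal (1 + 1 / ε) * δ n := by
    intro ε hε n
    simp only [hN, ha, hδdef]
    rw [← lintegral_const_mul _ (hψn n),
      ← lintegral_const_mul' _ _ ENNReal.ofReal_ne_top,
      ← lintegral_add_left ((hψn n).const_mul _)]
    refine lintegral_mono fun x => ?_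
    have := hadd ε hε (stepFn (c n) x) (f x - stepFn (c n) x)
    rwa [← heven (f x - stepFn (c n) x), add_sub_cancel, neg_sub] at this
  have hle2 : ∀ ε : ℝ, 0 < ε → ∀ n,
      a n ≤ ENNReal.ofReal (1 + ε) * N + ENNReal.ofReal (1 + 1 / ε) * δ n := by
    intro ε hε n
    simp only [hN, ha, hδdef]
    rw [← lintegral_const_mul'' _ hψf,
      ← lintegral_const_mul' _ _ ENNReal.ofReal_ne_top,
      ← lintegral_add_left' (hψf.const_mul _)]
    refine lintegral_mono fun x => ?_
    have := hadd ε hε (f x) (stepFn (c n) x - f x)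
    rwa [add_sub_cancel] at this
  have hδtop : ∀ᶠ n in atTop, δ n ≠ ⊤ := hδ0.eventually_ne ENNReal.zero_ne_top
  have hNtop : N ≠ ⊤ := by
    obtain ⟨n, hn⟩ := hδtop.exists
    refine ne_top_of_le_ne_top ?_ (hle1 1 one_pos n)
    exact ENNReal.add_ne_top.2 ⟨ENNReal.mul_ne_top ENNReal.ofReal_ne_top (hatop n),
      ENNReal.mul_ne_top ENNReal.ofReal_ne_top hn⟩
  refine ⟨hNtop, ?_⟩
  set r : ℝ := ‖∫ ω, Complex.exp (Complex.I * (Y ω : ℝ)) ∂P‖ with hr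
  have hexp : Tendsto (fun n => Real.exp (-(a n).toReal)) atTop (𝓝 r) := by
    refine (tendsto_integral_cexp (fun n => (measurable_stepInt hΛ (c n)).aemeasurable) hY).congr
      fun n => (key (c n)).2
  have hδr : Tendsto (fun n => (δ n).toReal) atTop (𝓝 0) := by
    simpa [Function.comp_def] using (ENNReal.tendsto_toReal ENNReal.zero_ne_top).comp hδ0
  have toReal_le : ∀ ε : ℝ, 0 < ε → ∀ u v w : ENNReal, v ≠ ⊤ → w ≠ ⊤ →
      u ≤ ENNReal.ofReal (1 + ε) * v + ENNReal.ofReal (1 + 1 / ε) * w →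
      u.toReal ≤ (1 + ε) * v.toReal + (1 + 1 / ε) * w.toReal := by
    intro ε hε u v w hv hw h
    have h1 := ENNReal.mul_ne_top (ENNReal.ofReal_ne_top (r := 1 + ε)) hv
    have h2 := ENNReal.mul_ne_top (ENNReal.ofReal_ne_top (r := 1 + 1 / ε)) hw
    have := ENNReal.toReal_mono (ENNReal.add_ne_top.2 ⟨h1, h2⟩) h
    rwa [ENNReal.toReal_add h1 h2, ENNReal.toReal_mul, ENNReal.toReal_mul,
      ENNReal.toReal_ofReal (by positivity), ENNReal.toReal_ofReal (by positivity)] at this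
  have hge : ∀ ε : ℝ, 0 < ε → Real.exp (-((1 + ε) * N.toReal)) ≤ r := by
    intro ε hε
    have hl : Tendsto (fun n => Real.exp (-((1 + ε) * N.toReal + (1 + 1 / ε) * (δ n).toReal)))
        atTop (𝓝 (Real.exp (-((1 + ε) * N.toReal)))) := by
      refine (Real.continuous_exp.tendsto _).comp (Tendsto.neg ?_)
      simpa using (hδr.const_mul (1 + 1 / ε)).const_add ((1 + ε) * N.toReal)
    refine le_of_tendsto_of_tendsto hl hexp ?_
    filter_upwards [hδtop] with n hn
    exact Real.exp_le_exp.2 (neg_le_neg (toReal_le ε hε _ _ _ hNtop hn (hle2 ε hε n)))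
  have hr0 : 0 ≤ r := norm_nonneg _
  -- Stated with a power of `r` rather than a logarithm, since `r > 0` need not be known here.
  have hle : ∀ ε : ℝ, 0 < ε → r ^ (1 + ε) ≤ Real.exp (-N.toReal) := by
    intro ε hε
    have hl : Tendsto (fun n => Real.exp (-(a n).toReal) ^ (1 + ε) *
        Real.exp (-((1 + 1 / ε) * (δ n).toReal))) atTop (𝓝 (r ^ (1 + ε) * Real.exp (-0))) := by
      refine (hexp.rpow_const (Or.inr (by positivity))).mul
        ((Real.continuous_exp.tendsto _).comp (Tendsto.neg ?_))
      simpa using hδr.const_mul (1 + 1 / ε)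
    rw [neg_zero, Real.exp_zero, mul_one] at hl
    refine le_of_tendsto hl ?_
    filter_upwards [hδtop] with n hn
    rw [← Real.exp_mul, ← Real.exp_add]
    refine Real.exp_le_exp.2 ?_
    have := toReal_le ε hε _ _ _ (hatop n) hn (hle1 ε hε n)
    linarith
  have hε0 : Tendsto (fun k : ℕ => 1 + 1 / ((k : ℝ) + 1)) atTop (𝓝 1) := by
    simpa using tendsto_one_div_add_atTop_nhds_zero_nat.const_add (1 : ℝ)
  refine le_antisymm ?_ ?_
  · have : Tendsto (fun k : ℕ => r ^ (1 + 1 / ((k : ℝ) + 1))) atTop (𝓝 (r ^ (1 : ℝ))) :=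
      tendsto_const_nhds.rpow hε0 (Or.inr one_pos)
    rw [Real.rpow_one] at this
    exact le_of_tendsto' this fun k => hle _ (by positivity)
  · have : Tendsto (fun k : ℕ => Real.exp (-((1 + 1 / ((k : ℝ) + 1)) * N.toReal))) atTop
        (𝓝 (Real.exp (-(1 * N.toReal)))) :=
      (Real.continuous_exp.tendsto _).comp (hε0.mul_const _).neg
    rw [one_mul] at this
    exact le_of_tendsto' this fun k => hge _ (by positivity)

end Steps

/-! ### Second moments of integrals -/

section Variance

variable {E Ω : Type*} [MeasurableSpace E] [MeasurableSpace Ω] {P : Measure Ω}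

lemma charFun_map_eq {Z : Ω → ℝ} (hZ : AEMeasurable Z P) (θ : ℝ) :
    charFun (P.map Z) θ = ∫ ω, Complex.exp (Complex.I * (θ * Z ω : ℝ)) ∂P := by
  rw [charFun_apply_real, integral_map hZ (by fun_prop)]
  refine integral_congr_ae (Eventually.of_forall fun ω => ?_)
  simp only
  push_cast
  ring_nf

variable [IsProbabilityMeasure P]

/-- The modulus of the characteristic function of `Y` is `1 - θ² Var(Y) / 2 + o(θ²)`. -/
lemma tendsto_one_sub_norm_charFun {Y : Ω → ℝ} (hY : MemLp Y 2 P) {h : ℕ → ℝ}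
    (h0 : Tendsto h atTop (𝓝 0)) (hpos : ∀ k, 0 < h k) :
    Tendsto (fun k => (1 - ‖∫ ω, Complex.exp (Complex.I * (h k * Y ω : ℝ)) ∂P‖) / h k ^ 2)
      atTop (𝓝 (Var[Y; P] / 2)) := by
  set V := Var[Y; P] with hV
  -- Centring changes only the phase of the characteristic function and removes the linear term of
  -- its Taylor expansion.
  set Z : Ω → ℝ := fun ω => Y ω - ∫ ω, Y ω ∂P with hZ
  have hZ2 : MemLp Z 2 P := hY.sub (memLp_const _)
  have hZm : AEMeasurable Z P := hZ2.aestronglyMeasurable.aemeasurable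
  have hnorm : ∀ θ : ℝ, ‖∫ ω, Complex.exp (Complex.I * (θ * Y ω : ℝ)) ∂P‖ =
      ‖charFun (P.map Z) θ‖ := by
    intro θ
    rw [charFun_map_eq hZm]
    have : ∀ ω, Complex.exp (Complex.I * (θ * Y ω : ℝ)) =
        Complex.exp ((θ * ∫ ω, Y ω ∂P : ℝ) * Complex.I) *
          Complex.exp (Complex.I * (θ * Z ω : ℝ)) := by
      intro ω
      rw [← Complex.exp_add, hZ]
      congr 1
      push_cast
      ring
    simp_rw [this]
    rw [integral_const_mul, norm_mul, Complex.norm_exp_ofReal_mul_I, one_mul]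
  simp_rw [hnorm]
  have hint : MemLp id 2 (P.map Z) := by
    rw [memLp_map_measure_iff (by fun_prop) hZm]
    exact hZ2
  have hprob : IsProbabilityMeasure (P.map Z) := Measure.isProbabilityMeasure_map hZm
  have hEZ : P[Z] = 0 := by
    rw [hZ, integral_sub (hY.integrable one_le_two) (integrable_const _)]
    simp
  have hEZ2 : P[Z ^ 2] = V := by
    rw [hV, variance_eq_integral hY.aestronglyMeasurable.aemeasurable]
    rfl
  have htaylor : (fun θ : ℝ => charFun (P.map Z) θ - (1 - (V * θ ^ 2 / 2 : ℝ))) =o[𝓝 0]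
      fun θ => θ ^ 2 := by
    have := taylor_isLittleO_univ (f := charFun (P.map Z)) (x₀ := (0 : ℝ)) (n := 2)
      (contDiff_charFun hint)
    refine (this.congr (fun θ => ?_) fun θ => by rw [sub_zero])
    rw [taylorWithinEval_charFun_two_zero hZm hint, hEZ, hEZ2]
    push_cast
    ring
  have hdiff : Tendsto (fun k => (‖charFun (P.map Z) (h k)‖ - (1 - V * h k ^ 2 / 2)) / h k ^ 2)
      atTop (𝓝 0) := by
    have h1 := ((htaylor.comp_tendsto h0).norm_norm).tendsto_div_nhds_zero
    refine squeeze_zero_norm' ?_ h1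
    have h2 : Tendsto (fun k => 1 - V * h k ^ 2 / 2) atTop (𝓝 1) := by
      simpa using (((h0.pow 2).const_mul V).div_const 2).const_sub 1
    -- For small `h` the real number `1 - V h² / 2` is nonnegative, hence its own modulus, and the
    -- reverse triangle inequality applies.
    filter_upwards [h2.eventually_const_le zero_lt_one] with k hk
    rw [norm_div]
    refine div_le_div_of_nonneg_right ?_ (norm_nonneg _)
    have h3 : ‖(1 - (V * h k ^ 2 / 2 : ℝ) : ℂ)‖ = 1 - V * h k ^ 2 / 2 := by
      rw [← Complex.ofReal_one, ← Complex.ofReal_sub, Complex.norm_real, Real.norm_of_nonneg hk]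
    rw [← h3]
    exact abs_norm_sub_norm_le _ _
  have := hdiff.const_sub (V / 2)
  rw [sub_zero] at this
  refine this.congr fun k => ?_
  have := (hpos k).ne'
  field_simp
  ring

/-- Squeeze between `1 - e^{-a} ≤ a ≤ e^a (1 - e^{-a})`, where `e^a → 1` because `1 - e^{-a} =
O(h²)`. -/
lemma tendsto_div_of_one_sub_exp {a h : ℕ → ℝ} {v : ℝ} (h0 : Tendsto h atTop (𝓝 0))
    (hpos : ∀ k, 0 < h k)
    (hlim : Tendsto (fun k => (1 - Real.exp (-a k)) / h k ^ 2) atTop (𝓝 v)) :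
    Tendsto (fun k => a k / h k ^ 2) atTop (𝓝 v) := by
  have h1 : Tendsto (fun k => Real.exp (-a k)) atTop (𝓝 1) := by
    have := (hlim.mul (h0.pow 2)).const_sub 1
    simp only [ne_eq, OfNat.ofNat_ne_zero, not_false_eq_true, zero_pow, mul_zero, sub_zero] at this
    refine this.congr fun k => ?_
    have := (hpos k).ne'
    field_simp
    ring
  have h2 : Tendsto (fun k => (Real.exp (-a k))⁻¹ * ((1 - Real.exp (-a k)) / h k ^ 2)) atTop
      (𝓝 v) := by
    simpa using (h1.inv₀ one_ne_zero).mul hlim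
  refine tendsto_of_tendsto_of_tendsto_of_le_of_le hlim h2 (fun k => ?_) fun k => ?_
  · have := hpos k
    have := Real.add_one_le_exp (-a k)
    simp only
    gcongr
    linarith
  · have := hpos k
    simp only
    rw [← mul_div_assoc]
    gcongr
    have h3 := Real.add_one_le_exp (a k)
    rw [Real.exp_neg, inv_inv, mul_sub, mul_inv_cancel₀ (Real.exp_pos _).ne']
    linarith

variable {S : Set (Set E)} {m : Measure E} {Λ : Set E → Ω → ℝ} {b : ℝ} {W : Measure ℝ}

/-- The isometry property of the integral with respect to `Λ`. -/
theorem IsApprox.variance_eq (hb : 0 ≤ b) (hW : IsLevyMeasure W)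
    (hΛ : IsIDRandomMeasure P S m (cumulant b W) Λ) (hS : IsExhaustingDeltaRing m S)
    {f : E → ℝ} {Y : Ω → ℝ} (hf : IsApprox P S m Λ f Y) (hY : MemLp Y 2 P) :
    ENNReal.ofReal Var[Y; P] = levyVariance b W * ∫⁻ x, ENNReal.ofReal (f x ^ 2) ∂m := by
  have hfm := hf.aemeasurable hS
  have hcont := continuous_symbol (b := b) hW
  set h : ℕ → ℝ := fun k => 1 / ((k : ℝ) + 1)
  have h0 : Tendsto h atTop (𝓝 0) := tendsto_one_div_add_atTop_nhds_zero_nat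
  have hpos : ∀ k, 0 < h k := fun k => by positivity
  have key : ∀ k, ∫⁻ x, symbol b W (h k * f x) ∂m ≠ ⊤ ∧
      ‖∫ ω, Complex.exp (Complex.I * (h k * Y ω : ℝ)) ∂P‖ =
        Real.exp (-(∫⁻ x, symbol b W (h k * f x) ∂m).toReal) := fun k =>
    (hf.smul (h k)).norm_integral_cexp hΛ hS symbol_zero (symbol_ne_top hW)
      (re_cumulant hb hW) hcont symbol_neg fun ε hε => symbol_add_le hb hε
  have hlim := tendsto_one_sub_norm_charFun hY h0 hpos
  simp_rw [fun k => (key k).2] at hlim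
  have hlim2 := tendsto_div_of_one_sub_exp h0 hpos hlim
  have hlim3 : Tendsto (fun k => ENNReal.ofReal (1 / h k ^ 2) *
      ∫⁻ x, symbol b W (h k * f x) ∂m) atTop (𝓝 (ENNReal.ofReal (Var[Y; P] / 2))) := by
    refine ((ENNReal.continuous_ofReal.tendsto _).comp hlim2).congr fun k => ?_
    have := hpos k
    rw [Function.comp_apply, div_eq_mul_one_div, mul_comm, ENNReal.ofReal_mul (by positivity),
      ENNReal.ofReal_toReal (key k).1]
  -- An identity in `[0, ∞]`: `symbol_le` bounds each term from above and Fatou's lemma bounds the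
  -- limit from below. Neither factor is assumed finite, and their finiteness is later deduced from
  -- it.
  have hhalf : ENNReal.ofReal (Var[Y; P] / 2) =
      levyVariance b W * ∫⁻ x, ENNReal.ofReal (f x ^ 2 / 2) ∂m := by
    refine le_antisymm ?_ ?_
    · refine le_of_tendsto' hlim3 fun k => ?_
      have := hpos k
      rw [← lintegral_const_mul' _ _ ENNReal.ofReal_ne_top,
        ← lintegral_const_mul'' _ (by fun_prop)]
      refine lintegral_mono fun x => ?_
      refine (mul_le_mul_right (symbol_le _) _).trans (le_of_eq ?_)
      rw [← mul_assoc, ← ENNReal.ofReal_mul (by positivity), mul_comm]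
      congr 2
      field_simp
    · rw [← hlim3.liminf_eq, ← lintegral_const_mul'' _ (by fun_prop)]
      simp_rw [← fun k => lintegral_const_mul' (μ := m) (ENNReal.ofReal (1 / h k ^ 2))
        (fun x => symbol b W (h k * f x)) ENNReal.ofReal_ne_top]
      refine le_trans (lintegral_mono fun x => ?_) (lintegral_liminf_le' fun k =>
        ((hcont.measurable.comp_aemeasurable (hfm.const_mul _)).const_mul _))
      rw [mul_comm]
      exact le_liminf_symbol (f x) h0 hpos
  have h2 : ∀ y : ℝ, ENNReal.ofReal y = ENNReal.ofReal 2 * ENNReal.ofReal (y / 2) := by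
    intro y
    rw [← ENNReal.ofReal_mul zero_le_two, mul_div_cancel₀ y two_ne_zero]
  rw [h2, hhalf, mul_left_comm, ← lintegral_const_mul' _ _ ENNReal.ofReal_ne_top]
  simp_rw [← h2]

end Variance

/-! ### Smoothness of the cumulant function -/

section Smooth

variable {b : ℝ} {W : Measure ℝ}

/-- The second cumulant `-(b + ∫ x² W(dx))`. -/
def secondCumulant (b : ℝ) (W : Measure ℝ) : ℝ := -(b + ∫ x, x ^ 2 ∂W)

lemma integrable_sq_of_levyVariance (h : levyVariance b W ≠ ⊤) :
    Integrable (fun x : ℝ => x ^ 2) W := by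
  refine ⟨by fun_prop, ?_⟩
  rw [hasFiniteIntegral_iff_ofReal (Eventually.of_forall fun x => sq_nonneg x)]
  exact (ENNReal.add_ne_top.1 h).2.lt_top

lemma levyVariance_eq (hb : 0 ≤ b) (h : levyVariance b W ≠ ⊤) :
    levyVariance b W = ENNReal.ofReal (-secondCumulant b W) := by
  have hsq := integrable_sq_of_levyVariance h
  rw [secondCumulant, neg_neg, ENNReal.ofReal_add hb (integral_nonneg fun x => sq_nonneg x),
    ofReal_integral_eq_lintegral_ofReal hsq (Eventually.of_forall fun x => sq_nonneg x)]
  rfl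

/-- Both `x (e^{isx} - 1)` and `x - τ(x)` are `O(x²)`, the latter because it vanishes on `[-1, 1]`.
So `x²` dominates the differentiated integrand. -/
lemma norm_cexp_sub_trunc_le (s x : ℝ) :
    ‖Complex.I * x * Complex.exp (Complex.I * (s * x : ℝ)) - Complex.I * (trunc x : ℝ)‖ ≤
      (|s| + 2) * x ^ 2 := by
  have h1 : Complex.I * x * Complex.exp (Complex.I * (s * x : ℝ)) - Complex.I * (trunc x : ℝ) =
      Complex.I * x * (Complex.exp (Complex.I * (s * x : ℝ)) - 1) +
        Complex.I * ((x - trunc x : ℝ) : ℂ) := by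
    push_cast
    ring
  have h2 : ‖Complex.I * x * (Complex.exp (Complex.I * (s * x : ℝ)) - 1)‖ ≤ |s| * x ^ 2 := by
    rw [norm_mul, norm_mul, Complex.norm_I, one_mul, Complex.norm_real, Real.norm_eq_abs]
    have := Real.norm_exp_I_mul_ofReal_sub_one_le (x := s * x)
    rw [Real.norm_eq_abs, abs_mul] at this
    calc |x| * _ ≤ |x| * (|s| * |x|) := by gcongr
      _ = |s| * x ^ 2 := by rw [← sq_abs x]; ring
  have h3 : ‖Complex.I * ((x - trunc x : ℝ) : ℂ)‖ ≤ 2 * x ^ 2 := by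
    rw [norm_mul, Complex.norm_I, one_mul, Complex.norm_real, Real.norm_eq_abs]
    by_cases hx : |x| ≤ 1
    · simp [trunc, hx, sq_nonneg]
    · push Not at hx
      have := abs_trunc_le x
      have := abs_sub x (trunc x)
      nlinarith [sq_abs x]
  rw [h1]
  refine (norm_add_le _ _).trans ?_
  linarith

lemma hasDerivAt_cumulant (hW : IsLevyMeasure W) (h : levyVariance b W ≠ ⊤) (s : ℝ) :
    HasDerivAt (cumulant b W) (-((b * s : ℝ) : ℂ) +
      ∫ x, (Complex.I * x * Complex.exp (Complex.I * (s * x : ℝ)) - Complex.I * (trunc x : ℝ)) ∂W)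
      s := by
  have htr := measurable_trunc
  refine HasDerivAt.add ?_ ?_
  · have h1 : HasDerivAt (fun s : ℝ => b / 2 * s ^ 2) (b * s) s := by
      refine ((hasDerivAt_pow 2 s).const_mul (b / 2)).congr_deriv ?_
      push_cast
      ring
    exact h1.ofReal_comp.neg
  · refine (hasDerivAt_integral_of_dominated_loc_of_deriv_le (Metric.ball_mem_nhds s one_pos)
      (F := fun s x => levyIntegrand s x)
      (F' := fun s x =>
        Complex.I * x * Complex.exp (Complex.I * (s * x : ℝ)) - Complex.I * (trunc x : ℝ))
      (bound := fun x => (|s| + 1 + 2) * x ^ 2)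
      (Eventually.of_forall fun t => (measurable_levyIntegrand t).aestronglyMeasurable)
      (integrable_levyIntegrand hW s) (by fun_prop) ?_
      ((integrable_sq_of_levyVariance h).const_mul _) ?_).2
    · refine Eventually.of_forall fun x t ht => (norm_cexp_sub_trunc_le t x).trans ?_
      rw [Metric.mem_ball, Real.dist_eq] at ht
      have := abs_sub_abs_le_abs_sub t s
      gcongr
      linarith
    · refine Eventually.of_forall fun x t _ => ?_
      have h1 : HasDerivAt (fun t : ℝ => Complex.I * ((t * x : ℝ) : ℂ)) (Complex.I * x) t := by
        have := (((hasDerivAt_id t).mul_const x).ofReal_comp).const_mul Complex.I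
        simpa using this
      have h2 : HasDerivAt (fun t : ℝ => Complex.I * ((t * trunc x : ℝ) : ℂ))
          (Complex.I * (trunc x : ℝ)) t := by
        have := (((hasDerivAt_id t).mul_const (trunc x)).ofReal_comp).const_mul Complex.I
        simpa using this
      have := (h1.cexp.sub_const 1).sub h2
      rwa [mul_comm (Complex.exp _)] at this

lemma hasDerivAt_deriv_cumulant (h : levyVariance b W ≠ ⊤) (hW : IsLevyMeasure W) (s : ℝ) :
    HasDerivAt (deriv (cumulant b W))
      (-(b : ℂ) + ∫ x, (-(x : ℂ) ^ 2 * Complex.exp (Complex.I * (s * x : ℝ))) ∂W) s := by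
  have htr := measurable_trunc
  have hd : deriv (cumulant b W) = fun s => _ := funext fun s => (hasDerivAt_cumulant hW h s).deriv
  rw [hd]
  refine HasDerivAt.add ?_ ?_
  · have h1 : HasDerivAt (fun s : ℝ => b * s) b s := by
      simpa using (hasDerivAt_id s).const_mul b
    exact h1.ofReal_comp.neg
  · refine (hasDerivAt_integral_of_dominated_loc_of_deriv_le (Metric.ball_mem_nhds s one_pos)
      (F := fun s x =>
        Complex.I * x * Complex.exp (Complex.I * (s * x : ℝ)) - Complex.I * (trunc x : ℝ))
      (F' := fun s x => -(x : ℂ) ^ 2 * Complex.exp (Complex.I * (s * x : ℝ)))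
      (bound := fun x => x ^ 2)
      (Eventually.of_forall fun t => by fun_prop)
      (((integrable_sq_of_levyVariance h).const_mul (|s| + 2)).mono' (by fun_prop)
        (Eventually.of_forall fun x => norm_cexp_sub_trunc_le s x)) (by fun_prop) ?_
      (integrable_sq_of_levyVariance h) ?_).2
    · refine Eventually.of_forall fun x t _ => le_of_eq ?_
      rw [norm_mul, mul_comm Complex.I, Complex.norm_exp_ofReal_mul_I, norm_neg, norm_pow,
        Complex.norm_real, Real.norm_eq_abs, sq_abs, mul_one]
    · refine Eventually.of_forall fun x t _ => ?_
      have h1 : HasDerivAt (fun t : ℝ => Complex.I * ((t * x : ℝ) : ℂ)) (Complex.I * x) t := by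
        have := (((hasDerivAt_id t).mul_const x).ofReal_comp).const_mul Complex.I
        simpa using this
      have := (h1.cexp.const_mul (Complex.I * x)).sub_const (Complex.I * (trunc x : ℝ))
      convert this using 1
      linear_combination (-(x : ℂ) ^ 2 * Complex.exp (Complex.I * (t * x : ℝ))) * Complex.I_sq

theorem contDiff_cumulant (hW : IsLevyMeasure W) (h : levyVariance b W ≠ ⊤) :
    ContDiff ℝ 2 (cumulant b W) := by
  have hdd : deriv (deriv (cumulant b W)) = fun s => _ :=
    funext fun s => (hasDerivAt_deriv_cumulant h hW s).deriv
  have h1 : ContDiff ℝ 1 (deriv (cumulant b W)) := by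
    rw [contDiff_one_iff_deriv]
    refine ⟨fun s => (hasDerivAt_deriv_cumulant h hW s).differentiableAt, ?_⟩
    rw [hdd]
    refine continuous_const.add (continuous_of_dominated (bound := fun x => x ^ 2)
      (fun s => by fun_prop) (fun s => Eventually.of_forall fun x => le_of_eq ?_)
      (integrable_sq_of_levyVariance h) (Eventually.of_forall fun x => by fun_prop))
    rw [norm_mul, mul_comm Complex.I, Complex.norm_exp_ofReal_mul_I, norm_neg, norm_pow,
      Complex.norm_real, Real.norm_eq_abs, sq_abs, mul_one]
  rw [show (2 : WithTop ℕ∞) = 1 + 1 by norm_num, contDiff_succ_iff_deriv]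
  exact ⟨fun s => (hasDerivAt_cumulant hW h s).differentiableAt, by simp, h1⟩

theorem iteratedDeriv_two_cumulant (hW : IsLevyMeasure W) (h : levyVariance b W ≠ ⊤) :
    iteratedDeriv 2 (cumulant b W) 0 = (secondCumulant b W : ℂ) := by
  rw [iteratedDeriv_succ, iteratedDeriv_one, (hasDerivAt_deriv_cumulant h hW 0).deriv]
  have : ∀ x : ℝ, -(x : ℂ) ^ 2 * Complex.exp (Complex.I * ((0 : ℝ) * x : ℝ)) =
      ((-(x ^ 2) : ℝ) : ℂ) := by
    intro x
    simp
  simp_rw [this]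
  rw [integral_complex_ofReal, integral_neg, secondCumulant]
  push_cast
  ring

end Smooth

/-! ### Bessel functions -/

section Bessel

lemma integrableOn_rpow_mul_exp_neg_mul_sub_div {ν a c : ℝ} (hν : 0 < ν) (ha : 0 < a)
    (hc : 0 ≤ c) :
    IntegrableOn (fun s : ℝ => s ^ (ν - 1) * Real.exp (-a * s - c / s)) (Set.Ioi 0) := by
  have h1 := integrableOn_rpow_mul_exp_neg_mul_rpow (p := 1) (s := ν - 1) (by linarith) one_pos ha
  refine Integrable.mono' h1 (by fun_prop) ?_
  filter_upwards [ae_restrict_mem measurableSet_Ioi] with s hs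
  have hs : 0 < s := hs
  have : 0 ≤ c / s := by positivity
  rw [Real.norm_of_nonneg (by positivity), Real.rpow_one]
  gcongr
  linarith

/-- The substitution `s = k e^v` balances the two terms of the exponent into `-x cosh v`. -/
lemma exp_change_of_variables {ν k x : ℝ} (hk : 0 < k) (v : ℝ) :
    |k * Real.exp v| • ((k * Real.exp v) ^ (ν - 1) *
      Real.exp (-(x / (2 * k)) * (k * Real.exp v) - x * k / 2 / (k * Real.exp v))) =
      k ^ ν * (Real.exp (-x * Real.cosh v) * Real.exp (ν * v)) := by
  have he := Real.exp_pos v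
  have hp : 0 < k * Real.exp v := by positivity
  have h1 : -(x / (2 * k)) * (k * Real.exp v) - x * k / 2 / (k * Real.exp v) =
      -x * Real.cosh v := by
    rw [Real.cosh_eq, Real.exp_neg]
    field_simp
    ring
  rw [abs_of_pos hp, smul_eq_mul, ← mul_assoc, h1, Real.rpow_sub_one hp.ne',
    mul_div_cancel₀ _ hp.ne', Real.mul_rpow hk.le he.le, ← Real.exp_mul, mul_comm v ν]
  ring

lemma image_mul_exp {k : ℝ} (hk : 0 < k) :
    (fun v => k * Real.exp v) '' Set.univ = Set.Ioi 0 := by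
  ext s
  simp only [Set.image_univ, Set.mem_range, Set.mem_Ioi]
  constructor
  · rintro ⟨v, rfl⟩
    positivity
  · intro hs
    exact ⟨Real.log (s / k), by rw [Real.exp_log (by positivity), mul_div_cancel₀ _ hk.ne']⟩

lemma integrable_exp_neg_mul_cosh_mul_exp {ν x : ℝ} (hν : 0 < ν) (hx : 0 < x) :
    Integrable (fun v => Real.exp (-x * Real.cosh v) * Real.exp (ν * v)) := by
  have h1 := integrableOn_rpow_mul_exp_neg_mul_sub_div (a := x / (2 * 1)) (c := x * 1 / 2) hν
    (by positivity) (by positivity)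
  rw [← image_mul_exp one_pos, integrableOn_image_iff_integrableOn_abs_deriv_smul
    MeasurableSet.univ (fun v _ => ((Real.hasDerivAt_exp v).const_mul 1).hasDerivWithinAt)
    (fun v _ w _ h => Real.exp_injective (by simpa using h)), integrableOn_univ] at h1
  simp_rw [exp_change_of_variables one_pos] at h1
  simpa using h1

/-- Folding the line at the origin turns `e^{νv}` into `2 cosh (νv)`. -/
lemma integral_exp_neg_mul_cosh_mul_exp {ν x : ℝ} (hν : 0 < ν) (hx : 0 < x) :
    ∫ v, Real.exp (-x * Real.cosh v) * Real.exp (ν * v) = 2 * besselK ν x := by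
  have h := integrable_exp_neg_mul_cosh_mul_exp hν hx
  have hneg : ∫ v in Set.Iic (0 : ℝ), Real.exp (-x * Real.cosh v) * Real.exp (ν * v) =
      ∫ v in Set.Ioi (0 : ℝ), Real.exp (-x * Real.cosh v) * Real.exp (-(ν * v)) := by
    have := integral_comp_neg_Ioi (0 : ℝ)
      (fun v => Real.exp (-x * Real.cosh v) * Real.exp (ν * v))
    rw [neg_zero] at this
    rw [← this]
    simp
  have h2 : IntegrableOn (fun v => Real.exp (-x * Real.cosh v) * Real.exp (-(ν * v)))
      (Set.Ioi 0) := by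
    have := h.comp_neg
    simp only [Real.cosh_neg, mul_neg] at this
    exact this.integrableOn
  rw [← intervalIntegral.integral_Iic_add_Ioi h.integrableOn h.integrableOn (b := 0), hneg,
    ← integral_add h2 h.integrableOn, besselK, ← integral_const_mul]
  refine integral_congr_ae (Eventually.of_forall fun v => ?_)
  simp only
  rw [Real.cosh_eq (ν * v)]
  ring

/-- For an exponent `-a s - c / s` the parameters are `x = 2 √(ac)` and `k = √(c / a)`. -/
lemma integral_rpow_mul_exp_neg_mul_sub_div {ν k x : ℝ} (hν : 0 < ν) (hk : 0 < k) (hx : 0 < x) :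
    ∫ s in Set.Ioi (0 : ℝ), s ^ (ν - 1) * Real.exp (-(x / (2 * k)) * s - x * k / 2 / s) =
      2 * k ^ ν * besselK ν x := by
  rw [← image_mul_exp hk, integral_image_eq_integral_abs_deriv_smul
    MeasurableSet.univ (fun v _ => ((Real.hasDerivAt_exp v).const_mul k).hasDerivWithinAt)
    (fun v _ w _ h => Real.exp_injective (mul_left_cancel₀ hk.ne' h))]
  simp_rw [exp_change_of_variables hk]
  rw [setIntegral_univ, integral_const_mul, integral_exp_neg_mul_cosh_mul_exp hν hx]
  ring

/-- With `y = sinh (v / 2)` one has `cosh v = 1 + 2 y²` and `cosh (v / 2) dv = 2 dy`, so the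
integral is Gaussian. -/
lemma besselK_one_half {x : ℝ} (hx : 0 < x) :
    besselK (1 / 2) x = √(Real.pi / (2 * x)) * Real.exp (-x) := by
  have hint := integrable_exp_neg_mul_cosh_mul_exp (ν := 1 / 2) (by norm_num) hx
  have h1 : ∫ v, Real.exp (-x * Real.cosh v) * Real.cosh (1 / 2 * v) = 2 * besselK (1 / 2) x := by
    have hint' := hint.comp_neg
    have hn := integral_neg_eq_self
      (fun v => Real.exp (-x * Real.cosh v) * Real.exp (1 / 2 * v)) volume
    rw [integral_exp_neg_mul_cosh_mul_exp (by norm_num) hx] at hn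
    have h3 : ∀ v, Real.exp (-x * Real.cosh v) * Real.cosh (1 / 2 * v) =
        2⁻¹ * (Real.exp (-x * Real.cosh v) * Real.exp (1 / 2 * v) +
          Real.exp (-x * Real.cosh (-v)) * Real.exp (1 / 2 * -v)) := by
      intro v
      rw [Real.cosh_eq (1 / 2 * v), Real.cosh_neg, mul_neg]
      ring
    simp_rw [h3]
    rw [integral_const_mul, integral_add hint hint', hn,
      integral_exp_neg_mul_cosh_mul_exp (by norm_num) hx]
    ring
  have hd : ∀ v ∈ Set.univ, HasDerivWithinAt (fun v => Real.sinh (1 / 2 * v))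
      (Real.cosh (1 / 2 * v) * (1 / 2)) Set.univ v := by
    intro v _
    have := ((hasDerivAt_id v).const_mul (1 / 2 : ℝ)).sinh
    simpa using this
  have himage : (fun v : ℝ => Real.sinh (1 / 2 * v)) '' Set.univ = Set.univ := by
    refine Set.image_univ_of_surjective fun y => ⟨2 * Real.arsinh y, ?_⟩
    simp
  have h2 := integral_image_eq_integral_abs_deriv_smul MeasurableSet.univ hd
    (fun v _ w _ h => by simpa using Real.sinh_injective h)
    (fun y => Real.exp (-(2 * x) * y ^ 2))
  rw [himage, setIntegral_univ, setIntegral_univ, integral_gaussian] at h2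
  have h4 : ∀ v, |Real.cosh (1 / 2 * v) * (1 / 2)| •
      Real.exp (-(2 * x) * Real.sinh (1 / 2 * v) ^ 2) =
        (Real.exp x / 2) * (Real.exp (-x * Real.cosh v) * Real.cosh (1 / 2 * v)) := by
    intro v
    have hc : Real.cosh v = 2 * Real.sinh (1 / 2 * v) ^ 2 + 1 := by
      have := Real.cosh_two_mul (1 / 2 * v)
      rw [Real.cosh_sq] at this
      rw [show 2 * (1 / 2 * v) = v by ring] at this
      linarith
    have he : -(2 * x) * Real.sinh (1 / 2 * v) ^ 2 = x + -x * Real.cosh v := by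
      rw [hc]
      ring
    rw [he, Real.exp_add, abs_of_pos (by positivity), smul_eq_mul]
    ring
  simp_rw [h4] at h2
  rw [integral_const_mul, h1] at h2
  rw [h2]
  have : Real.exp x * Real.exp (-x) = 1 := by rw [← Real.exp_add]; simp
  linear_combination (-besselK (1 / 2) x) * this

/-- `e^{-l r}` as a mixture of Gaussian functions of `r`. -/
lemma exp_neg_mul_eq_integral {l r : ℝ} (hl : 0 < l) (hr : 0 ≤ r) :
    Real.exp (-l * r) = l / (2 * √Real.pi) *
      ∫ s in Set.Ioi (0 : ℝ), s ^ (-(1 / 2) : ℝ) * Real.exp (-(l ^ 2 / 4) * s - r ^ 2 / s) := by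
  have hpi := Real.pi_pos
  rcases hr.eq_or_lt with rfl | hr
  -- At `r = 0` the Bessel argument `l r` degenerates, and a Gamma integral takes its place.
  · have h := Real.integral_rpow_mul_exp_neg_mul_Ioi (a := 1 / 2) (r := l ^ 2 / 4) (by norm_num)
      (by positivity)
    rw [Real.Gamma_one_half_eq, show (1 / 2 - 1 : ℝ) = -(1 / 2) by norm_num] at h
    have h2 : (1 / (l ^ 2 / 4)) ^ (1 / 2 : ℝ) = 2 / l := by
      rw [← Real.sqrt_eq_rpow, show 1 / (l ^ 2 / 4) = (2 / l) ^ 2 by field_simp; norm_num,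
        Real.sqrt_sq (by positivity)]
    rw [h2] at h
    simp only [mul_zero, Real.exp_zero, ne_eq, OfNat.ofNat_ne_zero, not_false_eq_true, zero_pow,
      zero_div, sub_zero, neg_mul]
    rw [h]
    field_simp
  · have h := integral_rpow_mul_exp_neg_mul_sub_div (ν := 1 / 2) (k := 2 * r / l) (x := l * r)
      (by norm_num) (by positivity) (by positivity)
    rw [besselK_one_half (by positivity), show (1 / 2 - 1 : ℝ) = -(1 / 2) by norm_num,
      show l * r / (2 * (2 * r / l)) = l ^ 2 / 4 by field_simp; norm_num,
      show l * r * (2 * r / l) / 2 = r ^ 2 by field_simp, ← Real.sqrt_eq_rpow,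
      mul_assoc 2, ← mul_assoc (√_) (√_), ← Real.sqrt_mul (by positivity),
      show 2 * r / l * (Real.pi / (2 * (l * r))) = Real.pi / l ^ 2 by field_simp,
      Real.sqrt_div hpi.le, Real.sqrt_sq hl.le] at h
    rw [h, neg_mul]
    field_simp

end Bessel

/-! ### Fourier transforms of Gaussian mixtures -/

section Fourier

open FourierTransform

variable {d : ℕ}

lemma integral_gaussian_space {β : ℝ} (hβ : 0 < β) :
    ∫ u : Space d, Real.exp (-β * ‖u‖ ^ 2) = (Real.pi / β) ^ ((d : ℝ) / 2) := by
  rw [GaussianFourier.integral_rexp_neg_mul_sq_norm hβ]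
  simp

lemma integrable_gaussian_space {β : ℝ} (hβ : 0 < β) :
    Integrable fun u : Space d => Real.exp (-β * ‖u‖ ^ 2) := by
  refine Integrable.of_integral_ne_zero ?_
  rw [integral_gaussian_space hβ]
  have := Real.pi_pos
  positivity

/-! ### Mixtures of Gaussians -/

section Mixture

variable {α : Type*} [MeasurableSpace α] {μ : Measure α} {ρ β : α → ℝ}

/-- The hypothesis `hint` is integrability of the total masses of the Gaussian components; it is all
that Fubini's theorem requires. -/
lemma integrable_prod_mixture (hρ : Measurable ρ) (hβ : Measurable β) (hpos : ∀ᵐ a ∂μ, 0 < β a)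
    (hint : Integrable (fun a => ρ a * (Real.pi / β a) ^ ((d : ℝ) / 2)) μ) :
    Integrable (fun p : α × Space d => ρ p.1 * Real.exp (-β p.1 * ‖p.2‖ ^ 2))
      (μ.prod volume) := by
  rw [integrable_prod_iff (Measurable.aestronglyMeasurable (by fun_prop))]
  constructor
  · filter_upwards [hpos] with a ha
    exact (integrable_gaussian_space ha).const_mul _
  · refine hint.norm.congr ?_
    filter_upwards [hpos] with a ha
    have hpi := Real.pi_pos
    simp only [norm_mul]
    rw [integral_const_mul]
    congr 1
    rw [← integral_gaussian_space ha, Real.norm_of_nonneg (integral_nonneg fun u => by positivity)]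
    exact integral_congr_ae (Eventually.of_forall fun u => by simp)

variable [SFinite μ]

lemma integrable_mixture (hρ : Measurable ρ) (hβ : Measurable β) (hpos : ∀ᵐ a ∂μ, 0 < β a)
    (hint : Integrable (fun a => ρ a * (Real.pi / β a) ^ ((d : ℝ) / 2)) μ) :
    Integrable fun u : Space d => ∫ a, ρ a * Real.exp (-β a * ‖u‖ ^ 2) ∂μ :=
  (integrable_prod_mixture hρ hβ hpos hint).integral_prod_right

lemma fourier_mixture (hρ : Measurable ρ) (hβ : Measurable β) (hpos : ∀ᵐ a ∂μ, 0 < β a)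
    (hint : Integrable (fun a => ρ a * (Real.pi / β a) ^ ((d : ℝ) / 2)) μ) (w : Space d) :
    𝓕 (fun u : Space d => ((∫ a, ρ a * Real.exp (-β a * ‖u‖ ^ 2) ∂μ : ℝ) : ℂ)) w =
      ((∫ a, ρ a * (Real.pi / β a) ^ ((d : ℝ) / 2) *
        Real.exp (-Real.pi ^ 2 * ‖w‖ ^ 2 / β a) ∂μ : ℝ) : ℂ) := by
  have hprod := integrable_prod_mixture hρ hβ hpos hint
  rw [Real.fourier_eq']
  have hswap : Integrable (Function.uncurry fun (u : Space d) (a : α) =>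
      Complex.exp (((-2 * Real.pi * inner ℝ u w : ℝ) : ℂ) * Complex.I) •
        ((ρ a * Real.exp (-β a * ‖u‖ ^ 2) : ℝ) : ℂ)) (volume.prod μ) := by
    refine (hprod.swap.norm).mono' (Measurable.aestronglyMeasurable (by fun_prop)) ?_
    refine Eventually.of_forall fun p => le_of_eq ?_
    simp only [Function.uncurry, norm_smul, Complex.norm_exp_ofReal_mul_I, one_mul,
      Complex.norm_real, Function.comp, Prod.swap]
  simp_rw [← integral_complex_ofReal, ← integral_smul]
  rw [integral_integral_swap hswap]
  refine integral_congr_ae ?_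
  filter_upwards [hpos] with a ha
  have h := fourier_gaussian_innerProductSpace (V := Space d) (b := (β a : ℂ)) (by simpa using ha) w
  rw [Real.fourier_eq'] at h
  have h1 : ∀ u : Space d, Complex.exp (((-2 * Real.pi * inner ℝ u w : ℝ) : ℂ) * Complex.I) •
      ((ρ a * Real.exp (-β a * ‖u‖ ^ 2) : ℝ) : ℂ) = (ρ a : ℂ) *
      (Complex.exp (((-2 * Real.pi * inner ℝ u w : ℝ) : ℂ) * Complex.I) •
        Complex.exp (-(β a : ℂ) * ‖u‖ ^ 2)) := by
    intro u
    simp only [smul_eq_mul]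
    push_cast
    ring
  simp_rw [h1]
  rw [integral_const_mul, h]
  have hpi := Real.pi_pos
  rw [finrank_euclideanSpace_fin]
  push_cast
  rw [Complex.ofReal_cpow (by positivity)]
  push_cast
  ring

end Mixture

/-! ### The exponential kernel and its convolution with itself -/

lemma integrable_inv_add_norm_sq_rpow {a c q : ℝ} (ha : 0 < a) (hc : 0 < c)
    (hq : (d : ℝ) < 2 * q) :
    Integrable fun w : Space d => (a + c * ‖w‖ ^ 2) ^ (-q) := by
  have h := integrable_rpow_neg_one_add_norm_sq (E := Space d) (μ := volume) (r := 2 * q)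
    (by simpa using hq)
  have h2 := (integrable_comp_smul_iff volume _ (R := √(c / a)) (by positivity)).2 h
  refine (h2.const_mul (a ^ (-q))).congr (Eventually.of_forall fun w => ?_)
  simp only
  rw [norm_smul, mul_pow, Real.norm_of_nonneg (Real.sqrt_nonneg _),
    Real.sq_sqrt (by positivity), show -(2 * q) / 2 = -q by ring,
    ← Real.mul_rpow (by positivity) (by positivity)]
  congr 1
  field_simp

/-- The constant in the Fourier transform of `e^{-l ‖u‖}`. -/
def expConst (d : ℕ) (l : ℝ) : ℝ :=
  l / (2 * √Real.pi) * Real.pi ^ ((d : ℝ) / 2) * Real.Gamma (((d : ℝ) + 1) / 2)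

lemma exp_neg_norm_eq_mixture {l : ℝ} (hl : 0 < l) (u : Space d) :
    Real.exp (-l * ‖u‖) = ∫ s in Set.Ioi (0 : ℝ),
      (l / (2 * √Real.pi) * s ^ (-(1 / 2) : ℝ) * Real.exp (-(l ^ 2 / 4 * s))) *
        Real.exp (-(1 / s) * ‖u‖ ^ 2) := by
  rw [exp_neg_mul_eq_integral hl (norm_nonneg u), ← integral_const_mul]
  refine integral_congr_ae (Eventually.of_forall fun s => ?_)
  simp only
  rw [mul_assoc (_ * _), ← Real.exp_add, mul_assoc]
  ring_nf

/-- The Gaussian mass `(π s)^{d/2}` turns the weight into a Gamma density of shape `(d + 1) / 2`, up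
to a constant. -/
lemma exp_mixture_weight {l s : ℝ} (hs : 0 < s) :
    (l / (2 * √Real.pi) * s ^ (-(1 / 2) : ℝ) * Real.exp (-(l ^ 2 / 4 * s))) *
      (Real.pi / (1 / s)) ^ ((d : ℝ) / 2) =
      l / (2 * √Real.pi) * Real.pi ^ ((d : ℝ) / 2) *
        (s ^ (((d : ℝ) + 1) / 2 - 1) * Real.exp (-(l ^ 2 / 4 * s))) := by
  have hpi := Real.pi_pos
  have h1 : (Real.pi / (1 / s)) ^ ((d : ℝ) / 2) =
      Real.pi ^ ((d : ℝ) / 2) * s ^ ((d : ℝ) / 2) := by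
    rw [div_div_eq_mul_div, div_one, Real.mul_rpow hpi.le hs.le]
  have h2 : s ^ (((d : ℝ) + 1) / 2 - 1) = s ^ (-(1 / 2) : ℝ) * s ^ ((d : ℝ) / 2) := by
    rw [← Real.rpow_add hs]
    congr 1
    ring
  rw [h1, h2]
  ring

lemma integrableOn_rpow_mul_exp_neg {a p : ℝ} (hp : 0 < p) (ha : 0 < a) :
    IntegrableOn (fun s : ℝ => s ^ (p - 1) * Real.exp (-(a * s))) (Set.Ioi 0) := by
  simpa using integrableOn_rpow_mul_exp_neg_mul_sub_div (c := 0) hp ha le_rfl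

lemma integrable_exp_mixture_weight {l : ℝ} (hl : 0 < l) :
    IntegrableOn (fun s : ℝ =>
      (l / (2 * √Real.pi) * s ^ (-(1 / 2) : ℝ) * Real.exp (-(l ^ 2 / 4 * s))) *
        (Real.pi / (1 / s)) ^ ((d : ℝ) / 2)) (Set.Ioi 0) := by
  refine ((integrableOn_rpow_mul_exp_neg (p := ((d : ℝ) + 1) / 2) (a := l ^ 2 / 4)
    (by positivity) (by positivity)).const_mul
    (l / (2 * √Real.pi) * Real.pi ^ ((d : ℝ) / 2))).congr ?_
  filter_upwards [ae_restrict_mem measurableSet_Ioi] with s hs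
  exact (exp_mixture_weight hs).symm

lemma ae_one_div_pos : ∀ᵐ s ∂(volume.restrict (Set.Ioi (0 : ℝ))), 0 < 1 / s := by
  filter_upwards [ae_restrict_mem measurableSet_Ioi] with s hs
  exact one_div_pos.2 hs

lemma integrable_exp_neg_norm {l : ℝ} (hl : 0 < l) :
    Integrable fun u : Space d => Real.exp (-l * ‖u‖) := by
  simp_rw [exp_neg_norm_eq_mixture hl]
  exact integrable_mixture (by fun_prop) (by fun_prop) ae_one_div_pos
    (integrable_exp_mixture_weight hl)

lemma fourier_exp_neg_norm {l : ℝ} (hl : 0 < l) (w : Space d) :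
    𝓕 (fun u : Space d => ((Real.exp (-l * ‖u‖) : ℝ) : ℂ)) w =
      ((expConst d l * (l ^ 2 / 4 + Real.pi ^ 2 * ‖w‖ ^ 2) ^ (-(((d : ℝ) + 1) / 2)) : ℝ) : ℂ) := by
  have hpi := Real.pi_pos
  simp_rw [exp_neg_norm_eq_mixture hl]
  rw [fourier_mixture (by fun_prop) (by fun_prop) ae_one_div_pos
    (integrable_exp_mixture_weight hl)]
  congr 1
  have h : ∀ s ∈ Set.Ioi (0 : ℝ),
      (l / (2 * √Real.pi) * s ^ (-(1 / 2) : ℝ) * Real.exp (-(l ^ 2 / 4 * s))) *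
        (Real.pi / (1 / s)) ^ ((d : ℝ) / 2) * Real.exp (-Real.pi ^ 2 * ‖w‖ ^ 2 / (1 / s)) =
      l / (2 * √Real.pi) * Real.pi ^ ((d : ℝ) / 2) * (s ^ (((d : ℝ) + 1) / 2 - 1) *
        Real.exp (-((l ^ 2 / 4 + Real.pi ^ 2 * ‖w‖ ^ 2) * s))) := by
    intro s hs
    rw [exp_mixture_weight hs, mul_assoc, mul_assoc (s ^ _), ← Real.exp_add]
    congr 3
    rw [div_div_eq_mul_div]
    ring
  rw [setIntegral_congr_fun measurableSet_Ioi h, integral_const_mul,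
    Real.integral_rpow_mul_exp_neg_mul_Ioi (by positivity) (by positivity), expConst,
    Real.rpow_neg (by positivity), one_div, Real.inv_rpow (by positivity)]
  ring

/-- The convolution `∫ e^{-l ‖u‖} e^{-l ‖t - u‖} du`. -/
def expConv {d : ℕ} (l : ℝ) (t : Space d) : ℝ :=
  ∫ u : Space d, Real.exp (-l * ‖u‖) * Real.exp (-l * ‖t - u‖)

/-- Continuity makes Fourier inversion valid at every point. -/
lemma continuous_expConv {l : ℝ} (hl : 0 < l) :
    Continuous fun t : Space d => ((expConv l t : ℝ) : ℂ) := by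
  refine Complex.continuous_ofReal.comp (continuous_of_dominated
    (bound := fun u => Real.exp (-l * ‖u‖)) (fun t => by fun_prop)
    (fun t => Eventually.of_forall fun u => ?_) (integrable_exp_neg_norm hl)
    (Eventually.of_forall fun u => by fun_prop))
  rw [Real.norm_of_nonneg (by positivity)]
  refine mul_le_of_le_one_right (by positivity) (Real.exp_le_one_iff.2 ?_)
  have := norm_nonneg (t - u)
  nlinarith

/-- The Fourier representation of the convolution of `e^{-l ‖u‖}` with itself. -/
lemma expConv_eq_integral {l : ℝ} (hl : 0 < l) (t : Space d) :
    (expConv l t : ℂ) = ∫ w : Space d, Complex.exp (((2 * Real.pi * inner ℝ w t : ℝ) : ℂ) *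
      Complex.I) * ((expConst d l ^ 2 *
        (l ^ 2 / 4 + Real.pi ^ 2 * ‖w‖ ^ 2) ^ (-((d : ℝ) + 1)) : ℝ) : ℂ) := by
  have hpi := Real.pi_pos
  set e : Space d → ℂ := fun u => ((Real.exp (-l * ‖u‖) : ℝ) : ℂ) with he
  have hint : Integrable e := (integrable_exp_neg_norm hl).ofReal
  have hconv : (fun t : Space d => ((expConv l t : ℝ) : ℂ)) =
      MeasureTheory.convolution e e (ContinuousLinearMap.mul ℂ ℂ) volume := by
    ext t
    rw [MeasureTheory.convolution_def, expConv, ← integral_complex_ofReal]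
    refine integral_congr_ae (Eventually.of_forall fun u => ?_)
    simp [he]
  have hF : ∀ w, 𝓕 (fun t : Space d => ((expConv l t : ℝ) : ℂ)) w = ((expConst d l ^ 2 *
        (l ^ 2 / 4 + Real.pi ^ 2 * ‖w‖ ^ 2) ^ (-((d : ℝ) + 1)) : ℝ) : ℂ) := by
    intro w
    rw [hconv, Real.fourier_mul_convolution_eq hint hint, fourier_exp_neg_norm hl,
      ← Complex.ofReal_mul]
    congr 1
    rw [mul_mul_mul_comm, ← Real.rpow_add (by positivity), ← sq]
    congr 2
    ring
  have hFint : Integrable (𝓕 (fun t : Space d => ((expConv l t : ℝ) : ℂ))) := by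
    rw [funext hF]
    refine Integrable.ofReal (Integrable.const_mul ?_ _)
    exact integrable_inv_add_norm_sq_rpow (by positivity) (by positivity) (by linarith)
  have hci : Integrable (fun t : Space d => ((expConv l t : ℝ) : ℂ)) := by
    rw [hconv]
    exact hint.integrable_convolution (ContinuousLinearMap.mul ℂ ℂ) hint
  have h := congrFun ((continuous_expConv hl).fourierInv_fourier_eq hci hFint) t
  rw [← h, Real.fourierInv_eq']
  simp_rw [hF, smul_eq_mul]

lemma rpow_neg_eq_mixture {a : ℝ} (ha : 0 < a) (w : Space d) :
    (a + Real.pi ^ 2 * ‖w‖ ^ 2) ^ (-((d : ℝ) + 1)) = ∫ s in Set.Ioi (0 : ℝ),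
      ((Real.Gamma ((d : ℝ) + 1))⁻¹ * s ^ (d : ℝ) * Real.exp (-(a * s))) *
        Real.exp (-(Real.pi ^ 2 * s) * ‖w‖ ^ 2) := by
  have hpi := Real.pi_pos
  have h := Real.integral_rpow_mul_exp_neg_mul_Ioi (a := (d : ℝ) + 1)
    (r := a + Real.pi ^ 2 * ‖w‖ ^ 2) (by positivity) (by positivity)
  have hG : 0 < Real.Gamma ((d : ℝ) + 1) := Real.Gamma_pos_of_pos (by positivity)
  rw [one_div, Real.inv_rpow (by positivity), ← Real.rpow_neg (by positivity),
    ← div_eq_iff hG.ne'] at h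
  rw [← h, div_eq_inv_mul, ← integral_const_mul]
  refine integral_congr_ae (Eventually.of_forall fun s => ?_)
  simp only
  rw [mul_assoc (_ * _), ← Real.exp_add, add_sub_cancel_right, mul_assoc]
  ring_nf

/-- The convolution of `e^{-l ‖u‖}` with itself as a Laplace type integral. -/
lemma expConv_eq_setIntegral {l : ℝ} (hl : 0 < l) (t : Space d) :
    expConv l t = expConst d l ^ 2 * ((Real.Gamma ((d : ℝ) + 1))⁻¹ *
      Real.pi ^ (-((d : ℝ) / 2)) * ∫ s in Set.Ioi (0 : ℝ), s ^ ((d : ℝ) / 2 + 1 - 1) *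
        Real.exp (-(l ^ 2 / 4) * s - ‖t‖ ^ 2 / s)) := by
  have hpi := Real.pi_pos
  have ha : 0 < l ^ 2 / 4 := by positivity
  have hweight : ∀ s ∈ Set.Ioi (0 : ℝ),
      ((Real.Gamma ((d : ℝ) + 1))⁻¹ * s ^ (d : ℝ) * Real.exp (-(l ^ 2 / 4 * s))) *
        (Real.pi / (Real.pi ^ 2 * s)) ^ ((d : ℝ) / 2) =
      (Real.Gamma ((d : ℝ) + 1))⁻¹ * Real.pi ^ (-((d : ℝ) / 2)) *
        (s ^ ((d : ℝ) / 2 + 1 - 1) * Real.exp (-(l ^ 2 / 4 * s))) := by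
    intro s hs
    have hs : 0 < s := hs
    have h1 : (Real.pi / (Real.pi ^ 2 * s)) ^ ((d : ℝ) / 2) =
        Real.pi ^ (-((d : ℝ) / 2)) * s ^ (-((d : ℝ) / 2)) := by
      rw [← Real.mul_rpow hpi.le hs.le, Real.rpow_neg (by positivity),
        ← Real.inv_rpow (by positivity)]
      congr 1
      field_simp
    have h2 : s ^ ((d : ℝ) / 2 + 1 - 1) = s ^ (d : ℝ) * s ^ (-((d : ℝ) / 2)) := by
      rw [← Real.rpow_add hs]
      congr 1
      ring
    rw [h1, h2]
    ring
  have hint : IntegrableOn (fun s : ℝ =>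
      ((Real.Gamma ((d : ℝ) + 1))⁻¹ * s ^ (d : ℝ) * Real.exp (-(l ^ 2 / 4 * s))) *
        (Real.pi / (Real.pi ^ 2 * s)) ^ ((d : ℝ) / 2)) (Set.Ioi 0) := by
    refine ((integrableOn_rpow_mul_exp_neg (p := (d : ℝ) / 2 + 1) (a := l ^ 2 / 4)
      (by positivity) ha).const_mul
      ((Real.Gamma ((d : ℝ) + 1))⁻¹ * Real.pi ^ (-((d : ℝ) / 2)))).congr ?_
    filter_upwards [ae_restrict_mem measurableSet_Ioi] with s hs
    exact (hweight s hs).symm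
  have hpos : ∀ᵐ s ∂(volume.restrict (Set.Ioi (0 : ℝ))), 0 < Real.pi ^ 2 * s := by
    filter_upwards [ae_restrict_mem measurableSet_Ioi] with s hs
    have hs : 0 < s := hs
    positivity
  -- Evaluated at `-t`, where the Fourier transform is the inverse transform at `t`.
  have hF := fourier_mixture (d := d) (by fun_prop) (by fun_prop) hpos hint (-t)
  rw [Real.fourier_eq'] at hF
  have h := expConv_eq_integral hl t
  have hE : ∀ w : Space d, Complex.exp (((2 * Real.pi * inner ℝ w t : ℝ) : ℂ) * Complex.I) *
      ((expConst d l ^ 2 * (l ^ 2 / 4 + Real.pi ^ 2 * ‖w‖ ^ 2) ^ (-((d : ℝ) + 1)) : ℝ) : ℂ) =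
      ((expConst d l ^ 2 : ℝ) : ℂ) * (Complex.exp (((-2 * Real.pi * inner ℝ w (-t) : ℝ) : ℂ) *
        Complex.I) • ((∫ s in Set.Ioi (0 : ℝ),
      ((Real.Gamma ((d : ℝ) + 1))⁻¹ * s ^ (d : ℝ) * Real.exp (-(l ^ 2 / 4 * s))) *
        Real.exp (-(Real.pi ^ 2 * s) * ‖w‖ ^ 2) : ℝ) : ℂ)) := by
    intro w
    rw [← rpow_neg_eq_mixture ha w, inner_neg_right, smul_eq_mul,
      Complex.ofReal_mul (expConst d l ^ 2)]
    simp only [neg_mul, mul_neg, neg_neg]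
    ring
  simp_rw [hE] at h
  rw [integral_const_mul, hF, ← Complex.ofReal_mul, Complex.ofReal_inj] at h
  rw [h, ← integral_const_mul (_ * _)]
  congr 1
  refine setIntegral_congr_fun measurableSet_Ioi fun s hs => ?_
  have hs' : 0 < s := hs
  rw [hweight s hs, mul_assoc, mul_assoc (s ^ _), ← Real.exp_add, norm_neg]
  congr 4
  · ring
  · rw [neg_mul, neg_div, mul_div_mul_left _ _ (by positivity)]

end Fourier

/-! ### The covariance kernel for a fixed mean reversion parameter -/

section Constants

variable {d : ℕ}

/-- Both parities give the same square, by Legendre's duplication formula in the even case. -/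
lemma c₁_sq (hd : 1 ≤ d) :
    c₁ d ^ 2 = 2 ^ d / 4 * Real.Gamma (((d : ℝ) + 1) / 2) ^ 2 / Real.pi := by
  have hpi := Real.pi_pos
  have hd0 : 0 < (d : ℝ) := by exact_mod_cast hd
  unfold c₁
  split_ifs with hodd
  · have h2 : ((2 : ℝ) ^ ((d : ℝ) / 2 - 1)) ^ 2 = 2 ^ d / 4 := by
      rw [← Real.rpow_natCast, ← Real.rpow_mul zero_le_two, ← Real.rpow_natCast 2 d,
        show (4 : ℝ) = 2 ^ (2 : ℝ) by norm_num, ← Real.rpow_sub two_pos]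
      congr 1
      push_cast
      ring
    rw [neg_sq, div_pow, mul_pow, h2, Real.sq_sqrt hpi.le]
  · have hdup := Real.Gamma_mul_Gamma_add_half ((d : ℝ) / 2)
    have hG : 0 < Real.Gamma ((d : ℝ) / 2) := Real.Gamma_pos_of_pos (by positivity)
    rw [mul_div_cancel₀ _ two_ne_zero, ← add_div] at hdup
    have hG2 : Real.Gamma (d : ℝ) / Real.Gamma ((d : ℝ) / 2) =
        Real.Gamma (((d : ℝ) + 1) / 2) / (2 ^ (1 - (d : ℝ)) * √Real.pi) := by
      rw [div_eq_div_iff hG.ne' (by positivity), ← mul_assoc, ← hdup]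
      ring
    have h2 : ((2 : ℝ) ^ (-(d : ℝ) / 2)) ^ 2 = (2 ^ d)⁻¹ := by
      rw [← Real.rpow_natCast, ← Real.rpow_mul zero_le_two, ← Real.rpow_natCast 2 d,
        ← Real.rpow_neg zero_le_two]
      congr 1
      push_cast
      ring
    have h3 : (2 : ℝ) ^ (1 - (d : ℝ)) = 2 / 2 ^ d := by
      rw [Real.rpow_sub two_pos, Real.rpow_one, Real.rpow_natCast]
    rw [neg_sq, mul_div_assoc, mul_pow, h2, hG2, h3, div_pow, mul_pow, Real.sq_sqrt hpi.le]
    field_simp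
    norm_num

lemma c₁_sq_pos (hd : 1 ≤ d) : 0 < c₁ d ^ 2 := by
  have hpi := Real.pi_pos
  have : 0 < Real.Gamma (((d : ℝ) + 1) / 2) := Real.Gamma_pos_of_pos (by positivity)
  rw [c₁_sq hd]
  positivity

lemma c₂_pos (hd : 1 ≤ d) : 0 < c₂ d := by
  have hpi := Real.pi_pos
  have h1 := c₁_sq_pos hd
  have : 0 < Real.Gamma ((d : ℝ) + 1) := Real.Gamma_pos_of_pos (by positivity)
  unfold c₂
  positivity

/-- The factor `l²` cancels. The powers of `2π` and 4 come from the passage to angular frequency. -/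
lemma expConst_sq (hd : 1 ≤ d) {l : ℝ} (hl : 0 < l) :
    expConst d l ^ 2 / (4 * l ^ 2) = c₁ d ^ 2 * (2 * Real.pi) ^ d / 4 ^ (d + 1) := by
  have hpi := Real.pi_pos
  have h1 : (Real.pi ^ ((d : ℝ) / 2)) ^ 2 = Real.pi ^ d := by
    rw [← Real.rpow_natCast, ← Real.rpow_mul hpi.le, ← Real.rpow_natCast]
    congr 1
    push_cast
    ring
  have h4 : (4 : ℝ) ^ (d + 1) = 4 * (2 ^ d * 2 ^ d) := by
    rw [← mul_pow, pow_succ]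
    norm_num
    ring
  rw [c₁_sq hd, expConst, mul_pow, mul_pow, div_pow, mul_pow, Real.sq_sqrt hpi.le, h1, h4, mul_pow]
  field_simp
  ring

/-- The covariance function `∫ (2l)⁻¹ e^{-l ‖u‖} (2l)⁻¹ e^{-l ‖t - u‖} du`. -/
def carCov (l : ℝ) (t : Space d) : ℝ := expConv l t / (4 * l ^ 2)

/-- Rescaling by `2π` passes from the kernel `e^{2πi⟨w,t⟩}` to `e^{i⟨w,t⟩}`. -/
lemma carCov_eq_integral (hd : 1 ≤ d) {l : ℝ} (hl : 0 < l) (t : Space d) :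
    (carCov l t : ℂ) = ((c₁ d ^ 2 : ℝ) : ℂ) *
      ∫ w : Space d, Complex.exp (Complex.I * (inner ℝ w t : ℝ)) *
        ((((‖w‖ ^ 2 + l ^ 2) ^ (d + 1))⁻¹ : ℝ) : ℂ) := by
  have hpi := Real.pi_pos
  have hscale := Measure.integral_comp_smul (volume : Measure (Space d))
    (fun w => Complex.exp (Complex.I * (inner ℝ w t : ℝ)) *
        ((((‖w‖ ^ 2 + l ^ 2) ^ (d + 1))⁻¹ : ℝ) : ℂ)) (2 * Real.pi)
  have hF : ∀ w : Space d, Complex.exp (Complex.I * (inner ℝ ((2 * Real.pi) • w) t : ℝ)) *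
        ((((‖(2 * Real.pi) • w‖ ^ 2 + l ^ 2) ^ (d + 1))⁻¹ : ℝ) : ℂ) =
      (((4 : ℝ) ^ (d + 1))⁻¹ : ℝ) * (Complex.exp (((2 * Real.pi * inner ℝ w t : ℝ) : ℂ) *
      Complex.I) * (((l ^ 2 / 4 + Real.pi ^ 2 * ‖w‖ ^ 2) ^ (-((d : ℝ) + 1)) : ℝ) : ℂ)) := by
    intro w
    have h1 : ((‖(2 * Real.pi) • w‖ ^ 2 + l ^ 2) ^ (d + 1))⁻¹ =
        ((4 : ℝ) ^ (d + 1))⁻¹ * (l ^ 2 / 4 + Real.pi ^ 2 * ‖w‖ ^ 2) ^ (-((d : ℝ) + 1)) := by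
      rw [Real.rpow_neg (by positivity), ← mul_inv, ← Nat.cast_add_one, Real.rpow_natCast,
        ← mul_pow, norm_smul, Real.norm_of_nonneg (by positivity)]
      congr 2
      ring
    rw [h1, inner_smul_left, Complex.ofReal_mul ((4 : ℝ) ^ (d + 1))⁻¹, mul_comm Complex.I]
    simp only [conj_trivial]
    ring
  simp_rw [hF] at hscale
  rw [integral_const_mul, finrank_euclideanSpace_fin, abs_of_pos (by positivity),
    Complex.real_smul] at hscale
  have hI : ∫ w : Space d, Complex.exp (Complex.I * (inner ℝ w t : ℝ)) *
        ((((‖w‖ ^ 2 + l ^ 2) ^ (d + 1))⁻¹ : ℝ) : ℂ) =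
      (((2 * Real.pi) ^ d / 4 ^ (d + 1) : ℝ) : ℂ) *
      ∫ w : Space d, Complex.exp (((2 * Real.pi * inner ℝ w t : ℝ) : ℂ) *
        Complex.I) * (((l ^ 2 / 4 + Real.pi ^ 2 * ‖w‖ ^ 2) ^ (-((d : ℝ) + 1)) : ℝ) : ℂ) := by
    have h2 : (((2 * Real.pi) ^ d : ℝ) : ℂ) * ((((2 * Real.pi) ^ d)⁻¹ : ℝ) : ℂ) = 1 := by
      rw [← Complex.ofReal_mul, mul_inv_cancel₀ (by positivity), Complex.ofReal_one]
    rw [div_eq_mul_inv, Complex.ofReal_mul, mul_assoc, hscale, ← mul_assoc, h2, one_mul]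
  rw [hI, ← mul_assoc, ← Complex.ofReal_mul, ← mul_div_assoc, ← expConst_sq hd hl, carCov,
    Complex.ofReal_div, expConv_eq_integral hl, ← integral_const_mul, div_eq_mul_inv, mul_comm,
    ← integral_const_mul]
  refine integral_congr_ae (Eventually.of_forall fun w => ?_)
  simp only
  push_cast
  ring

/-- Common source of the Bessel formula for `t ≠ 0` and the Gamma formula for `t = 0`. -/
lemma carCov_eq_setIntegral (hd : 1 ≤ d) {l : ℝ} (hl : 0 < l) (t : Space d) :
    carCov l t = c₂ d * (2 * 2 ^ ((d : ℝ) / 2 + 1))⁻¹ *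
      ∫ s in Set.Ioi (0 : ℝ), s ^ ((d : ℝ) / 2 + 1 - 1) *
        Real.exp (-(l ^ 2 / 4) * s - ‖t‖ ^ 2 / s) := by
  have hpi := Real.pi_pos
  have hG : 0 < Real.Gamma ((d : ℝ) + 1) := Real.Gamma_pos_of_pos (by positivity)
  have h := expConst_sq hd hl
  rw [carCov, expConv_eq_setIntegral hl, mul_div_right_comm, h, ← mul_assoc]
  congr 1
  have h2 : ((2 : ℝ) ^ ((d : ℝ) / 2)) ^ 2 = 2 ^ d := by
    rw [← Real.rpow_natCast, ← Real.rpow_mul zero_le_two, ← Real.rpow_natCast]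
    congr 1
    push_cast
    ring
  have h3 : (Real.pi ^ ((d : ℝ) / 2)) ^ 2 = Real.pi ^ d := by
    rw [← Real.rpow_natCast, ← Real.rpow_mul hpi.le, ← Real.rpow_natCast]
    congr 1
    push_cast
    ring
  have h4 : (4 : ℝ) ^ (d + 1) = 4 * (2 ^ d * 2 ^ d) := by
    rw [← mul_pow, pow_succ]
    norm_num
    ring
  rw [c₂, Real.div_rpow hpi.le zero_le_two, h4, mul_pow, ← h2, ← h3,
    Real.rpow_neg hpi.le, Real.rpow_add_one two_ne_zero]
  have h5 : (0 : ℝ) < 2 ^ ((d : ℝ) / 2) := by positivity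
  have h6 : 0 < Real.pi ^ ((d : ℝ) / 2) := by positivity
  field_simp
  ring_nf

lemma carCov_eq_besselK (hd : 1 ≤ d) {l : ℝ} (hl : 0 < l) {t : Space d} (ht : t ≠ 0) :
    carCov l t = c₂ d * ‖t‖ ^ ((d : ℝ) / 2 + 1) *
      (l ^ (-(d : ℝ) / 2 - 1) * besselK ((d : ℝ) / 2 + 1) (l * ‖t‖)) := by
  have ht' : 0 < ‖t‖ := norm_pos_iff.2 ht
  have h := integral_rpow_mul_exp_neg_mul_sub_div (ν := (d : ℝ) / 2 + 1) (k := 2 * ‖t‖ / l)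
    (x := l * ‖t‖) (by positivity) (by positivity) (by positivity)
  rw [show l * ‖t‖ / (2 * (2 * ‖t‖ / l)) = l ^ 2 / 4 by field_simp; norm_num,
    show l * ‖t‖ * (2 * ‖t‖ / l) / 2 = ‖t‖ ^ 2 by field_simp] at h
  rw [carCov_eq_setIntegral hd hl, h, Real.div_rpow (by positivity) hl.le,
    Real.mul_rpow zero_le_two ht'.le, show -(d : ℝ) / 2 - 1 = -((d : ℝ) / 2 + 1) by ring,
    Real.rpow_neg hl.le]
  field_simp

lemma carCov_zero (hd : 1 ≤ d) {l : ℝ} (hl : 0 < l) :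
    carCov l (0 : Space d) = c₂ d * (2 ^ ((d : ℝ) / 2) * Real.Gamma ((d : ℝ) / 2 + 1)) *
      (l ^ (d + 2))⁻¹ := by
  have h := Real.integral_rpow_mul_exp_neg_mul_Ioi (a := (d : ℝ) / 2 + 1) (r := l ^ 2 / 4)
    (by positivity) (by positivity)
  rw [carCov_eq_setIntegral hd hl]
  simp only [norm_zero, ne_eq, OfNat.ofNat_ne_zero, not_false_eq_true, zero_pow, zero_div,
    sub_zero, neg_mul]
  rw [h]
  have h1 : (1 / (l ^ 2 / 4)) ^ ((d : ℝ) / 2 + 1) =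
      (2 ^ ((d : ℝ) / 2 + 1)) ^ 2 * (l ^ (d + 2))⁻¹ := by
    rw [show 1 / (l ^ 2 / 4) = (2 / l) ^ 2 by field_simp; norm_num, ← Real.rpow_natCast,
      ← Real.rpow_mul (by positivity), ← Real.rpow_natCast (2 ^ _), ← Real.rpow_mul zero_le_two,
      Real.div_rpow zero_le_two hl.le, ← Real.rpow_natCast l (d + 2), div_eq_mul_inv]
    push_cast
    ring_nf
  rw [h1, Real.rpow_add_one two_ne_zero]
  field_simp

end Constants

/-! ### The kernel of a supCAR field -/

section Kernel

variable {d : ℕ}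

@[fun_prop]
lemma measurable_kernel (t : Space d) : Measurable (kernel t) := by
  unfold kernel
  fun_prop

/-- After translation by `s` the product no longer involves `s`: this is the homogeneity of the
field. -/
lemma kernel_mul_kernel (s t : Space d) (l : PosReal) (v : Space d) :
    kernel s (l, s + v) * kernel (s + t) (l, s + v) =
      (4 * (l : ℝ) ^ 2)⁻¹ * (Real.exp (-(l : ℝ) * ‖v‖) * Real.exp (-(l : ℝ) * ‖t - v‖)) := by
  have hl : (l : ℝ) ≠ 0 := (ne_of_gt l.2)
  simp only [kernel]
  rw [sub_add_cancel_left, norm_neg, add_sub_add_left_eq_sub]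
  field_simp
  norm_num

lemma integrable_kernel_mul_kernel (s t : Space d) (l : PosReal) :
    Integrable fun u => kernel s (l, u) * kernel (s + t) (l, u) := by
  have hl : 0 < (l : ℝ) := l.2
  refine ((measurePreserving_add_left volume s).integrable_comp_emb
    (MeasurableEquiv.addLeft s).measurableEmbedding).1 ?_
  simp only [Function.comp_def, kernel_mul_kernel]
  refine Integrable.const_mul ((integrable_exp_neg_norm hl).mono' (by fun_prop)
    (Eventually.of_forall fun u => ?_)) _
  rw [Real.norm_of_nonneg (by positivity)]
  refine mul_le_of_le_one_right (by positivity) (Real.exp_le_one_iff.2 ?_)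
  have := norm_nonneg (t - u)
  nlinarith

lemma integral_kernel_mul_kernel (s t : Space d) (l : PosReal) :
    ∫ u, kernel s (l, u) * kernel (s + t) (l, u) = carCov (l : ℝ) t := by
  rw [← integral_add_left_eq_self _ s]
  simp_rw [kernel_mul_kernel]
  rw [integral_const_mul, carCov, expConv, div_eq_inv_mul]

/-- The constant in the variance of a supCAR field. -/
def varConst (d : ℕ) : ℝ := c₂ d * (2 ^ ((d : ℝ) / 2) * Real.Gamma ((d : ℝ) / 2 + 1))

lemma varConst_pos (hd : 1 ≤ d) : 0 < varConst d := by
  have := c₂_pos hd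
  have : 0 < Real.Gamma ((d : ℝ) / 2 + 1) := Real.Gamma_pos_of_pos (by positivity)
  unfold varConst
  positivity

variable {π : Measure PosReal}

lemma lintegral_kernel_sq (hd : 1 ≤ d) (s : Space d) :
    ∫⁻ p, ENNReal.ofReal (kernel s p ^ 2) ∂(π.prod volume) =
      ∫⁻ l : PosReal, ENNReal.ofReal (varConst d * ((l : ℝ) ^ (d + 2))⁻¹) ∂π := by
  rw [lintegral_prod _ (by fun_prop)]
  refine lintegral_congr fun l => ?_
  have h1 := integrable_kernel_mul_kernel s 0 l
  have h2 := integral_kernel_mul_kernel s 0 l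
  simp only [add_zero, ← sq] at h1 h2
  rw [← ofReal_integral_eq_lintegral_ofReal h1 (Eventually.of_forall fun u => sq_nonneg _), h2,
    carCov_zero hd l.2]
  rfl

/-- Excludes the case `⊤ * 0 = 0` when finiteness of `levyVariance` is deduced from the isometry. -/
lemma lintegral_kernel_sq_ne_zero [IsProbabilityMeasure π] (hd : 1 ≤ d) (s : Space d) :
    ∫⁻ p, ENNReal.ofReal (kernel s p ^ 2) ∂(π.prod volume) ≠ 0 := by
  rw [lintegral_kernel_sq hd s]
  intro h
  rw [lintegral_eq_zero_iff (by fun_prop)] at h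
  obtain ⟨l, hl⟩ := h.exists
  have h1 : 0 < (l : ℝ) := l.2
  have h2 := varConst_pos hd
  have : 0 < varConst d * ((l : ℝ) ^ (d + 2))⁻¹ := by positivity
  simp only [Pi.zero_apply, ENNReal.ofReal_eq_zero] at hl
  linarith

lemma integrable_inv_pow (hd : 1 ≤ d) {s : Space d}
    (h : ∫⁻ p, ENNReal.ofReal (kernel s p ^ 2) ∂(π.prod volume) ≠ ⊤) :
    Integrable (fun l : PosReal => ((l : ℝ) ^ (d + 2))⁻¹) π := by
  have hc := varConst_pos hd
  rw [lintegral_kernel_sq hd] at h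
  have : Integrable (fun l : PosReal => varConst d * ((l : ℝ) ^ (d + 2))⁻¹) π := by
    refine ⟨by fun_prop, ?_⟩
    rw [hasFiniteIntegral_iff_ofReal (Eventually.of_forall fun l => ?_)]
    · exact h.lt_top
    · have h1 : 0 < (l : ℝ) := l.2
      positivity
  exact (integrable_const_mul_iff (isUnit_iff_ne_zero.2 hc.ne') _).1 this

lemma memLp_kernel {s : Space d}
    (h : ∫⁻ p, ENNReal.ofReal (kernel s p ^ 2) ∂(π.prod volume) ≠ ⊤) :
    MemLp (kernel s) 2 (π.prod volume) := by
  rw [memLp_two_iff_integrable_sq (by fun_prop)]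
  refine ⟨by fun_prop, ?_⟩
  rw [hasFiniteIntegral_iff_ofReal (Eventually.of_forall fun p => sq_nonneg _)]
  exact h.lt_top

/-- The function `(l, w) ↦ (‖w‖² + l²)^{-(d + 1)}` is integrable. -/
lemma integrable_spectral (hd : 1 ≤ d)
    (h : Integrable (fun l : PosReal => ((l : ℝ) ^ (d + 2))⁻¹) π) :
    Integrable (fun p : PosReal × Space d => ((‖p.2‖ ^ 2 + (p.1 : ℝ) ^ 2) ^ (d + 1))⁻¹)
      (π.prod volume) := by
  have hc := c₁_sq_pos hd
  -- The integral over `w` is found by comparing the spectral formula at `t = 0` with `carCov_zero`.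
  have hint : ∀ l : PosReal, ∫ w : Space d, ((‖w‖ ^ 2 + (l : ℝ) ^ 2) ^ (d + 1))⁻¹ =
      varConst d / c₁ d ^ 2 * ((l : ℝ) ^ (d + 2))⁻¹ := by
    intro l
    have h1 := carCov_eq_integral hd l.2 (0 : Space d)
    simp only [inner_zero_right, Complex.ofReal_zero, mul_zero, Complex.exp_zero, one_mul] at h1
    rw [integral_complex_ofReal, ← Complex.ofReal_mul, Complex.ofReal_inj, carCov_zero hd l.2] at h1
    rw [div_mul_eq_mul_div, eq_div_iff hc.ne', varConst, h1]
    ring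
  rw [integrable_prod_iff (Measurable.aestronglyMeasurable (by fun_prop))]
  constructor
  · refine Eventually.of_forall fun l => ?_
    have hl : 0 < (l : ℝ) := l.2
    refine (integrable_inv_add_norm_sq_rpow (d := d) (a := (l : ℝ) ^ 2) (c := 1)
      (q := (d : ℝ) + 1) (by positivity) one_pos (by linarith)).congr
      (Eventually.of_forall fun w => ?_)
    simp only
    rw [Real.rpow_neg (by positivity), ← Nat.cast_add_one, Real.rpow_natCast, one_mul, add_comm]
  · refine (h.const_mul (varConst d / c₁ d ^ 2)).congr (Eventually.of_forall fun l => ?_)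
    simp only
    rw [← hint l]
    refine integral_congr_ae (Eventually.of_forall fun w => ?_)
    simp only
    rw [Real.norm_of_nonneg (by positivity)]

/-- For `w ≠ 0` the integrand is bounded; at `w = 0` it is `l^{-2(d+1)}`, which may fail to be
integrable near zero. -/
lemma integrable_inv_norm_sq_add_pow [IsFiniteMeasure π] {w : Space d} (hw : w ≠ 0) :
    Integrable (fun l : PosReal => ((‖w‖ ^ 2 + (l : ℝ) ^ 2) ^ (d + 1))⁻¹) π := by
  have hw' : 0 < ‖w‖ := norm_pos_iff.2 hw
  refine Integrable.mono' (integrable_const ((‖w‖ ^ 2) ^ (d + 1))⁻¹) (by fun_prop)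
    (Eventually.of_forall fun l => ?_)
  rw [Real.norm_of_nonneg (by positivity)]
  gcongr
  nlinarith [sq_nonneg (l : ℝ)]

/-- The mixture of the covariance functions `carCov l` has a spectral density. -/
lemma integral_carCov_eq_integral [SFinite π] (hd : 1 ≤ d)
    (h : Integrable (fun l : PosReal => ((l : ℝ) ^ (d + 2))⁻¹) π) (t : Space d) :
    ((∫ l : PosReal, carCov (l : ℝ) t ∂π : ℝ) : ℂ) =
      ((c₁ d ^ 2 : ℝ) : ℂ) * ∫ w : Space d, Complex.exp (Complex.I * (inner ℝ w t : ℝ)) *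
        ((∫ l : PosReal, ((‖w‖ ^ 2 + (l : ℝ) ^ 2) ^ (d + 1))⁻¹ ∂π : ℝ) : ℂ) := by
  rw [← integral_complex_ofReal]
  simp_rw [fun l : PosReal => carCov_eq_integral hd l.2 t]
  rw [integral_const_mul]
  congr 1
  have hs := integrable_spectral hd h
  rw [integral_integral_swap]
  · refine integral_congr_ae (Eventually.of_forall fun w => ?_)
    simp only
    rw [integral_const_mul, integral_complex_ofReal]
  · refine hs.mono' (Measurable.aestronglyMeasurable (by fun_prop))
      (Eventually.of_forall fun p => le_of_eq ?_)
    simp only [Function.uncurry]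
    rw [norm_mul, mul_comm Complex.I, Complex.norm_exp_ofReal_mul_I, one_mul, Complex.norm_real,
      Real.norm_of_nonneg (by positivity)]

end Kernel

/-! ### Second order structure of supCAR fields -/

section Covariance

variable {Ω : Type*} [MeasurableSpace Ω] {P : Measure Ω} [IsProbabilityMeasure P] {d : ℕ} {b : ℝ}
  {W : Measure ℝ} {π : Measure PosReal} {X : Space d → Ω → ℝ}

lemma IsSupCAR.variance_eq (hX : IsSupCAR P b W π X) (hb : 0 ≤ b) (hW : IsLevyMeasure W)
    (hmom : ∀ t, MemLp (X t) 2 P) (t : Space d) :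
    ENNReal.ofReal Var[X t; P] =
      levyVariance b W * ∫⁻ p, ENNReal.ofReal (kernel t p ^ 2) ∂(π.prod volume) := by
  obtain ⟨S, Λ, hS, hΛ, hint⟩ := hX
  exact (hint t).isApprox.variance_eq hb hW hΛ hS (hmom t)

lemma IsSupCAR.variance_add_eq (hX : IsSupCAR P b W π X) (hb : 0 ≤ b) (hW : IsLevyMeasure W)
    (hmom : ∀ t, MemLp (X t) 2 P) (s t : Space d) :
    ENNReal.ofReal Var[X s + X t; P] = levyVariance b W *
      ∫⁻ p, ENNReal.ofReal ((kernel s p + kernel t p) ^ 2) ∂(π.prod volume) := by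
  obtain ⟨S, Λ, hS, hΛ, hint⟩ := hX
  exact ((hint s).isApprox.add (hint t).isApprox).variance_eq hb hW hΛ hS ((hmom s).add (hmom t))

/-- An infinite factor times a nonzero one would make the variance infinite. The same argument with
the factors exchanged gives `lintegral_kernel_sq_ne_top`. -/
lemma IsSupCAR.levyVariance_ne_top [IsProbabilityMeasure π] (hX : IsSupCAR P b W π X)
    (hd : 1 ≤ d) (hb : 0 ≤ b) (hW : IsLevyMeasure W) (hmom : ∀ t, MemLp (X t) 2 P) :
    levyVariance b W ≠ ⊤ := by
  intro h
  have h1 := hX.variance_eq hb hW hmom 0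
  rw [h, ENNReal.top_mul (lintegral_kernel_sq_ne_zero hd 0)] at h1
  exact ENNReal.ofReal_ne_top h1

lemma secondCumulant_nonpos (hb : 0 ≤ b) : secondCumulant b W ≤ 0 := by
  have : 0 ≤ ∫ x, x ^ 2 ∂W := integral_nonneg fun x => sq_nonneg x
  unfold secondCumulant
  linarith

lemma IsSupCAR.lintegral_kernel_sq_ne_top [IsProbabilityMeasure π] (hX : IsSupCAR P b W π X)
    (hd : 1 ≤ d) (hb : 0 ≤ b) (hW : IsLevyMeasure W) (hmom : ∀ t, MemLp (X t) 2 P)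
    (hκ : secondCumulant b W ≠ 0)
    (t : Space d) : ∫⁻ p, ENNReal.ofReal (kernel t p ^ 2) ∂(π.prod volume) ≠ ⊤ := by
  intro h
  have h1 := hX.variance_eq hb hW hmom t
  have h2 : ENNReal.ofReal (-secondCumulant b W) ≠ 0 := by
    rw [ne_eq, ENNReal.ofReal_eq_zero, not_le, neg_pos]
    exact lt_of_le_of_ne (secondCumulant_nonpos hb) hκ
  rw [h, levyVariance_eq hb (hX.levyVariance_ne_top hd hb hW hmom), ENNReal.mul_top h2] at h1
  exact ENNReal.ofReal_ne_top h1

/-- Polarization of the isometry, using the variance of `X s + X (s + t)`. -/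
theorem IsSupCAR.covariance_eq [IsProbabilityMeasure π] (hX : IsSupCAR P b W π X)
    (hd : 1 ≤ d) (hb : 0 ≤ b) (hW : IsLevyMeasure W) (hmom : ∀ t, MemLp (X t) 2 P) (s t : Space d) :
    cov[X s, X (s + t); P] = -secondCumulant b W * ∫ l : PosReal, carCov (l : ℝ) t ∂π := by
  have htop := hX.levyVariance_ne_top hd hb hW hmom
  set κ := secondCumulant b W with hκdef
  have hκ0 : 0 ≤ -κ := neg_nonneg.2 (secondCumulant_nonpos hb)
  have hvar : ∀ t, Var[X t; P] =
      -κ * (∫⁻ p, ENNReal.ofReal (kernel t p ^ 2) ∂(π.prod volume)).toReal := by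
    intro t
    have := congrArg ENNReal.toReal (hX.variance_eq hb hW hmom t)
    rwa [ENNReal.toReal_ofReal (variance_nonneg _ _), levyVariance_eq hb htop,
      ENNReal.toReal_mul, ENNReal.toReal_ofReal hκ0] at this
  have hadd : Var[X s + X (s + t); P] = -κ * (∫⁻ p,
      ENNReal.ofReal ((kernel s p + kernel (s + t) p) ^ 2) ∂(π.prod volume)).toReal := by
    have := congrArg ENNReal.toReal (hX.variance_add_eq hb hW hmom s (s + t))
    rwa [ENNReal.toReal_ofReal (variance_nonneg _ _), levyVariance_eq hb htop,
      ENNReal.toReal_mul, ENNReal.toReal_ofReal hκ0] at this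
  have hpol := variance_add (hmom s) (hmom (s + t))
  rw [hadd, hvar, hvar] at hpol
  -- If `κ = 0` the kernels need not be square integrable, but all the variances vanish and so does
  -- the covariance.
  by_cases hκ : κ = 0
  · rw [hκ] at hpol ⊢
    linarith
  have hf := hX.lintegral_kernel_sq_ne_top hd hb hW hmom hκ
  have hLp : ∀ t, MemLp (kernel t) 2 (π.prod volume) := fun t => memLp_kernel (hf t)
  have hreal : ∀ g : PosReal × Space d → ℝ, Measurable g →
      (∫⁻ p, ENNReal.ofReal (g p ^ 2) ∂(π.prod volume)).toReal =
        ∫ p, g p ^ 2 ∂(π.prod volume) := by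
    intro g hg
    rw [integral_eq_lintegral_of_nonneg_ae (Eventually.of_forall fun p => sq_nonneg _)
      (by fun_prop)]
  have hmul : Integrable (fun p => kernel s p * kernel (s + t) p) (π.prod volume) :=
    (hLp s).integrable_mul (hLp (s + t))
  have hsum : ∫ p, (kernel s p + kernel (s + t) p) ^ 2 ∂(π.prod volume) =
      ∫ p, kernel s p ^ 2 ∂(π.prod volume) + 2 * ∫ p, kernel s p * kernel (s + t) p ∂(π.prod volume)
        + ∫ p, kernel (s + t) p ^ 2 ∂(π.prod volume) := by
    rw [← integral_const_mul, ← integral_add (hLp s).integrable_sq (hmul.const_mul 2),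
      ← integral_add (by exact (hLp s).integrable_sq.add (hmul.const_mul 2))
        (hLp (s + t)).integrable_sq]
    refine integral_congr_ae (Eventually.of_forall fun p => ?_)
    simp only
    ring
  rw [hreal _ (by fun_prop), hreal _ (by fun_prop), hreal _ (by fun_prop), hsum,
    integral_prod _ hmul] at hpol
  simp_rw [integral_kernel_mul_kernel] at hpol
  linarith

lemma IsSupCAR.integrable_carCov [IsProbabilityMeasure π] (hX : IsSupCAR P b W π X)
    (hd : 1 ≤ d) (hb : 0 ≤ b) (hW : IsLevyMeasure W) (hmom : ∀ t, MemLp (X t) 2 P)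
    (hκ : secondCumulant b W ≠ 0)
    (t : Space d) : Integrable (fun l : PosReal => carCov (l : ℝ) t) π := by
  have hf := hX.lintegral_kernel_sq_ne_top hd hb hW hmom hκ
  have h := ((memLp_kernel (hf 0)).integrable_mul (memLp_kernel (hf (0 + t)))).integral_prod_left
  refine h.congr (Eventually.of_forall fun l => ?_)
  exact integral_kernel_mul_kernel 0 t l

end Covariance

end SupCAR

end

/-! ### Covariance function and spectral density -/

theorem theorem2 {Ω : Type*} [MeasurableSpace Ω] (P : Measure Ω) [IsProbabilityMeasure P]
    (d : ℕ) (hd : 1 ≤ d) (b : ℝ) (hb : 0 ≤ b) (W : Measure ℝ) (hW : SupCAR.IsLevyMeasure W)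
    (π : Measure SupCAR.PosReal) [IsProbabilityMeasure π]
    (hex : SupCAR.ExistenceCondition d b W π)
    (X : SupCAR.Space d → Ω → ℝ) (hX : SupCAR.IsSupCAR P b W π X)
    (hmom : ∀ t, MemLp (X t) 2 P) (hmean : ∀ t, ∫ ω, X t ω ∂P = 0) :
    ∃ (κ : ℝ) (r : SupCAR.Space d → ℝ),
      -- the second derivative `κ = K''(0)` of the cumulant function exists and is real
      ContDiff ℝ 2 (SupCAR.cumulant b W) ∧
      iteratedDeriv 2 (SupCAR.cumulant b W) 0 = (κ : ℂ) ∧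
      -- the covariance function; its value at `t = 0` is the limit as `t → 0`
      SupCAR.IsCovarianceFunction P X r ∧
      (∀ t, t ≠ 0 → r t = -SupCAR.c₂ d * κ * ‖t‖ ^ ((d : ℝ) / 2 + 1) *
        ∫ l : SupCAR.PosReal, (l : ℝ) ^ (-(d : ℝ) / 2 - 1) *
          SupCAR.besselK ((d : ℝ) / 2 + 1) (l * ‖t‖) ∂π) ∧
      r 0 = -SupCAR.c₂ d * κ * ((2 : ℝ) ^ ((d : ℝ) / 2) * Real.Gamma ((d : ℝ) / 2 + 1)) *
        ∫ l : SupCAR.PosReal, ((l : ℝ) ^ (d + 2))⁻¹ ∂π ∧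
      -- the integrals in the covariance function converge unless the field is identically zero
      (κ ≠ 0 →
        (∀ t : SupCAR.Space d, t ≠ 0 → Integrable (fun l : SupCAR.PosReal =>
          (l : ℝ) ^ (-(d : ℝ) / 2 - 1) *
            SupCAR.besselK ((d : ℝ) / 2 + 1) (l * ‖t‖)) π) ∧
        Integrable (fun l : SupCAR.PosReal => ((l : ℝ) ^ (d + 2))⁻¹) π) ∧
      -- the spectral density (defined almost everywhere; its integral converges for `w ≠ 0`)
      SupCAR.IsSpectralDensity r (fun w => -SupCAR.c₁ d ^ 2 * κ *
        ∫ l : SupCAR.PosReal, ((‖w‖ ^ 2 + (l : ℝ) ^ 2) ^ (d + 1))⁻¹ ∂π) ∧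
      (∀ w : SupCAR.Space d, w ≠ 0 → Integrable (fun l : SupCAR.PosReal =>
        ((‖w‖ ^ 2 + (l : ℝ) ^ 2) ^ (d + 1))⁻¹) π) := by
  have htop := hX.levyVariance_ne_top hd hb hW hmom
  set κ := SupCAR.secondCumulant b W with hκdef
  have hκ0 : κ ≤ 0 := SupCAR.secondCumulant_nonpos hb
  have hinv : κ ≠ 0 → Integrable (fun l : SupCAR.PosReal => ((l : ℝ) ^ (d + 2))⁻¹) π := fun hκ =>
    SupCAR.integrable_inv_pow hd (hX.lintegral_kernel_sq_ne_top hd hb hW hmom hκ 0)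
  refine ⟨κ, fun t => -κ * ∫ l : SupCAR.PosReal, SupCAR.carCov (l : ℝ) t ∂π,
    SupCAR.contDiff_cumulant hW htop, SupCAR.iteratedDeriv_two_cumulant hW htop,
    hX.covariance_eq hd hb hW hmom, fun t ht => ?_, ?_, fun hκ => ⟨fun t ht => ?_, hinv hκ⟩,
    ⟨fun w => ?_, ?_, fun t => ?_⟩, fun w hw => SupCAR.integrable_inv_norm_sq_add_pow hw⟩
  · simp_rw [fun l : SupCAR.PosReal => SupCAR.carCov_eq_besselK hd l.2 ht]
    rw [integral_const_mul]
    ring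
  · simp_rw [fun l : SupCAR.PosReal => SupCAR.carCov_zero hd l.2]
    rw [integral_const_mul]
    ring
  · have h := hX.integrable_carCov hd hb hW hmom hκ t
    simp_rw [fun l : SupCAR.PosReal => SupCAR.carCov_eq_besselK hd l.2 ht] at h
    have ht' : 0 < ‖t‖ := norm_pos_iff.2 ht
    have hc := SupCAR.c₂_pos hd
    exact (integrable_const_mul_iff (isUnit_iff_ne_zero.2 (by positivity)) _).1 h
  · have h1 : 0 ≤ -SupCAR.c₁ d ^ 2 * κ := by nlinarith [sq_nonneg (SupCAR.c₁ d)]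
    -- At `w = 0` the integral may diverge; its default value 0 is harmless.
    exact mul_nonneg h1 (integral_nonneg fun l => by positivity)
  -- For `κ = 0` nothing is known about the convergence of `∫ l^{-d-2} dπ`, but the density is
  -- identically zero.
  · by_cases hκ : κ = 0
    · simp [hκ]
    · exact (SupCAR.integrable_spectral hd (hinv hκ)).integral_prod_right.const_mul _
  · by_cases hκ : κ = 0
    · simp [hκ]
    · rw [Complex.ofReal_mul, SupCAR.integral_carCov_eq_integral hd (hinv hκ), ← mul_assoc,
        ← integral_const_mul]
      refine integral_congr_ae (Eventually.of_forall fun w => ?_)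
      simp only
      push_cast
      ring
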